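/- Let $(X,S,Y)$ be random variables with values in $\mathcal X\times\{1,2\}\times\mathbb R$, where $\mathcal X$ is any measurable space, with $\mathbb P(S=1)>0$, $\mathbb P(S=2)>0$ and $\mathbb E[Y^2]<\infty$. Let $\mu$ be the law of $X$ and $\mu_s$ the conditional law of $X$ given $S=s$, and assume $\mu_1\neq\mu_2$. Let $(\mu_1-\mu_2)_\pm$ be the positive and negative parts in the Jordan decomposition of $\mu_1-\mu_2$, let $m>0$ be their common mass, and let $\mu_\pm=(\mu_1-\mu_2)_\pm/m$. Let $\eta$ be a (measurable) version of $\eta(x)=\mathbb E[Y\mid X=x]$, and fix versions of the densities $\frac{d\mu_+}{d\mu},\frac{d\mu_-}{d\mu}:\mathcal X\to[0,\infty)$ such that $\mathcal X_+=\{\frac{d\mu_+}{d\mu}>0\}$ and $\mathcal X_-=\{\frac{d\mu_-}{d\mu}>0\}$ are disjoint; put $\mathcal X_{=}=\mathcal X\setminus(\mathcal X_+\cup\mathcal X_-)$. Define $\Delta=\frac{d\mu_+}{d\mu}$ on $\mathcal X_+$, $\Delta=-\frac{d\mu_-}{d\mu}$ on $\mathcal X_-$ and $\Delta=0$ on $\mathcal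 X_=$. For $f_+,f_-,f_=:\mathcal X\to\mathbb R$ let $\mathcal F(f_+,f_-,f_=)$ be the function equal to $f_+$ on $\mathcal X_+$, $f_-$ on $\mathcal X_-$ and $f_=$ on $\mathcal X_=$. Let $\boldsymbol{\mu}_\pm$ be the law of $(\eta(X),\Delta(X))$ when $X\sim\mu_\pm$; it is concentrated on $\{(h,d)\in\mathbb R^2: d\neq 0\}$. For $d\ne0$ let $\mathbf c((h,d),y)=(h-y)^2/|d|$, and let $\mathrm{OT}_{\mathbf c}(\boldsymbol\mu_\pm,\nu)=\inf_\pi\int \mathbf c\,d\pi\in[0,\infty]$, the infimum being over all couplings $\pi$ of $\boldsymbol\mu_\pm$ and $\nu$. Assume that $\boldsymbol\mu_+$ and $\boldsymbol\mu_-$ give zero mass to $\{(F(d),d): d\neq0\}$ for every measurable $F:\mathbb R\setminus\{0\}\to\mathbb R$. Then: 1. The barycenter problem of minimizing $\mathrm{OT}_{\mathbf c}(\boldsymbol\mu_+,\nu)+\mathrm{OT}_{\mathbf c}(\boldsymbol\mu_-,\nu)$ over all probability measures $\nu$ on $\mathbb R$ has a unique minimizer $\nu^{\mathrm{bar}}$.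 2. It is solved by optimal transport maps: there are measurable $\boldsymbol f_\pm$ with $\boldsymbol f_\pm\sharp\boldsymbol\mu_\pm=\nu^{\mathrm{bar}}$ and $\int\mathbf c(\mathbf x,\boldsymbol f_\pm(\mathbf x))\,d\boldsymbol\mu_\pm(\mathbf x)=\mathrm{OT}_{\mathbf c}(\boldsymbol\mu_\pm,\nu^{\mathrm{bar}})$. 3. For any such maps $\boldsymbol f_\pm$, the function $$f^*(x)=\mathcal F\bigl(\boldsymbol f_+(\eta(x),\Delta(x)),\,\boldsymbol f_-(\eta(x),\Delta(x)),\,\eta(x)\bigr)$$ minimizes $\mathbb E[(Y-f(X))^2]$ over all measurable $f:\mathcal X\to\mathbb R$ such that $f(X)$ is independent of $S$, and every minimizer of this problem is equal to $f^*$ $\mu$-almost everywhere. -/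

import Mathlib

open MeasureTheory ProbabilityTheory
open scoped ENNReal NNReal

noncomputable section

namespace FairRegression

/-! ### Optimal transport -/

/-- `π` is a transport plan between `μ` and `ν`. -/
def IsTransportPlan {α β : Type*} [MeasurableSpace α] [MeasurableSpace β]
    (μ : Measure α) (ν : Measure β) (π : Measure (α × β)) : Prop :=
  π.map Prod.fst = μ ∧ π.map Prod.snd = ν

/-- The optimal transport cost between `μ` and `ν` for the cost function `c`, in `[0, ∞]`. -/
def OT {α β : Type*} [MeasurableSpace α] [MeasurableSpace β]
    (c : α → β → ℝ≥0∞) (μ : Measure α) (ν : Measure β) : ℝ≥0∞ :=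
  ⨅ (π : Measure (α × β)) (_ : IsTransportPlan μ ν π), ∫⁻ z, c z.1 z.2 ∂π

/-- `T` is a transport map from `μ` to `ν` that attains the optimal transport cost. -/
def IsOptimalTransportMap {α β : Type*} [MeasurableSpace α] [MeasurableSpace β]
    (c : α → β → ℝ≥0∞) (μ : Measure α) (ν : Measure β) (T : α → β) : Prop :=
  Measurable T ∧ μ.map T = ν ∧ ∫⁻ x, c x (T x) ∂μ = OT c μ ν

/-- The two-to-one dimensional cost `c((h, d), y) = (h - y)² / |d|`. It is used against measures
that give no mass to `{d = 0}`. -/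
def cost (p : ℝ × ℝ) (y : ℝ) : ℝ≥0∞ :=
  ENNReal.ofReal ((p.1 - y) ^ 2) / ENNReal.ofReal |p.2|

/-- `ν` minimizes `OT_c(bp, ν) + OT_c(bm, ν)` over all probability measures on `ℝ`. -/
def IsBarycenter (bp bm : Measure (ℝ × ℝ)) (ν : Measure ℝ) : Prop :=
  IsProbabilityMeasure ν ∧
    ∀ ν' : Measure ℝ, IsProbabilityMeasure ν' →
      OT cost bp ν + OT cost bm ν ≤ OT cost bp ν' + OT cost bm ν'

/-- `b` gives zero mass to the graphs `{(F(d), d) : d ≠ 0}` of measurable functions. -/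
def NullOnGraphs (b : Measure (ℝ × ℝ)) : Prop :=
  ∀ F : {d : ℝ // d ≠ 0} → ℝ, Measurable F →
    b (Set.range fun d : {d : ℝ // d ≠ 0} => (F d, (d : ℝ))) = 0

/-! ### The regression problem -/

section Regression

variable {Ω 𝒳 : Type*} [MeasurableSpace Ω] [MeasurableSpace 𝒳]

/-- The quadratic risk `E[(Y - f(X))²]`, in `[0, ∞]`. -/
def risk (P : Measure Ω) (X : Ω → 𝒳) (Y : Ω → ℝ) (f : 𝒳 → ℝ) : ℝ≥0∞ :=
  ∫⁻ ω, ENNReal.ofReal ((Y ω - f (X ω)) ^ 2) ∂P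

/-- Demographic parity: `f(X)` is independent of `S`. -/
def DemographicParity (P : Measure Ω) (X : Ω → 𝒳) (S : Ω → ℕ) (f : 𝒳 → ℝ) : Prop :=
  IndepFun (fun ω => f (X ω)) S P

/-- `f` minimizes the quadratic risk among all regression functions `𝒳 → ℝ` that satisfy
demographic parity. -/
def IsOptimalFair (P : Measure Ω) (X : Ω → 𝒳) (S : Ω → ℕ) (Y : Ω → ℝ) (f : 𝒳 → ℝ) : Prop :=
  Measurable f ∧ DemographicParity P X S f ∧
    ∀ g : 𝒳 → ℝ, Measurable g → DemographicParity P X S g → risk P X Y f ≤ risk P X Y g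

/-- `η` is a version of the Bayes regression function `x ↦ E[Y | X = x]`. -/
def IsBayesRegression (P : Measure Ω) (X : Ω → 𝒳) (Y : Ω → ℝ) (η : 𝒳 → ℝ) : Prop :=
  Measurable η ∧ (fun ω => η (X ω)) =ᵐ[P] P[Y | MeasurableSpace.comap X inferInstance]

/-- The conditional law of `X` given `S = s`. -/
def condLaw (P : Measure Ω) (X : Ω → 𝒳) (S : Ω → ℕ) (s : ℕ) : Measure 𝒳 :=
  (ProbabilityTheory.cond P (S ⁻¹' {s})).map X

end Regression

/-! ### The scaled Jordan decomposition -/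

section Jordan

variable {𝒳 : Type*} [MeasurableSpace 𝒳]

/-- The Jordan decomposition of `μ₁ - μ₂`. -/
def jordan (μ₁ μ₂ : Measure 𝒳) [IsFiniteMeasure μ₁] [IsFiniteMeasure μ₂] :
    JordanDecomposition 𝒳 :=
  (μ₁.toSignedMeasure - μ₂.toSignedMeasure).toJordanDecomposition

/-- `(μ₁ - μ₂)₊ / m`, where `m` is the mass of `(μ₁ - μ₂)₊`. -/
def scaledPos (μ₁ μ₂ : Measure 𝒳) [IsFiniteMeasure μ₁] [IsFiniteMeasure μ₂] : Measure 𝒳 :=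
  ((jordan μ₁ μ₂).posPart Set.univ)⁻¹ • (jordan μ₁ μ₂).posPart

/-- `(μ₁ - μ₂)₋ / m`, where `m` is the mass of `(μ₁ - μ₂)₋` (the same as that of
`(μ₁ - μ₂)₊` when `μ₁` and `μ₂` are probability measures). -/
def scaledNeg (μ₁ μ₂ : Measure 𝒳) [IsFiniteMeasure μ₁] [IsFiniteMeasure μ₂] : Measure 𝒳 :=
  ((jordan μ₁ μ₂).negPart Set.univ)⁻¹ • (jordan μ₁ μ₂).negPart

/-- `ρp`, `ρm` are versions of the densities of `μp`, `μm` with respect to `μ` that are nowhere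
both positive, so that `{ρp > 0}`, `{ρm > 0}` and the complement of their union partition `𝒳`. -/
structure AreDisjointDensities (μ μp μm : Measure 𝒳) (ρp ρm : 𝒳 → ℝ≥0) : Prop where
  measurable_pos : Measurable ρp
  measurable_neg : Measurable ρm
  density_pos : μ.withDensity (fun x => (ρp x : ℝ≥0∞)) = μp
  density_neg : μ.withDensity (fun x => (ρm x : ℝ≥0∞)) = μm
  disjoint : Disjoint {x | 0 < ρp x} {x | 0 < ρm x}

open Classical in
/-- The function equal to `fp` on `{ρp > 0}`, to `fm` on `{ρm > 0}` and to `fe` elsewhere. -/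
def glue (ρp ρm : 𝒳 → ℝ≥0) (fp fm fe : 𝒳 → ℝ) (x : 𝒳) : ℝ :=
  if 0 < ρp x then fp x else if 0 < ρm x then fm x else fe x

/-- `Δ` equals `dμ₊/dμ` on `{dμ₊/dμ > 0}`, `- dμ₋/dμ` on `{dμ₋/dμ > 0}`, and `0` elsewhere. -/
def Delta (ρp ρm : 𝒳 → ℝ≥0) : 𝒳 → ℝ :=
  glue ρp ρm (fun x => (ρp x : ℝ)) (fun x => -(ρm x : ℝ)) (fun _ => 0)

/-- The law of `(η(X), Δ(X))` when `X` has law `μ`. -/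
def featureLaw (μ : Measure 𝒳) (η Δ : 𝒳 → ℝ) : Measure (ℝ × ℝ) :=
  μ.map fun x => (η x, Δ x)

end Jordan

section Groups

variable {Ω 𝒳 : Type*} [MeasurableSpace Ω] [MeasurableSpace 𝒳]

instance condLaw_isFiniteMeasure (P : Measure Ω) (X : Ω → 𝒳) (S : Ω → ℕ) (s : ℕ) :
    IsFiniteMeasure (condLaw P X S s) := by
  unfold condLaw
  infer_instance

/-- `μ₊`, the scaled positive part of `μ₁ - μ₂`, where `μ_s` is the law of `X` given `S = s`. -/
def muPos (P : Measure Ω) (X : Ω → 𝒳) (S : Ω → ℕ) : Measure 𝒳 :=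
  scaledPos (condLaw P X S 1) (condLaw P X S 2)

/-- `μ₋`, the scaled negative part of `μ₁ - μ₂`, where `μ_s` is the law of `X` given `S = s`. -/
def muNeg (P : Measure Ω) (X : Ω → 𝒳) (S : Ω → ℕ) : Measure 𝒳 :=
  scaledNeg (condLaw P X S 1) (condLaw P X S 2)

end Groups

end FairRegression

end

/-! By orthogonality of the residual `Y - η(X)`, the risk of `f` is the risk of `η` plus `∫ (η - f)²
dμ`. Since `μ₁ + m μ₋ = μ₂ + m μ₊`, demographic parity says exactly that `f` has the same law under
`μ₊` and `μ₋`. As `|Δ|` is the density of `μ±` on `𝒳±`, the distance to `η` is the sum of the costs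
of two transport plans, `((η, Δ), f)` under `μ₊` and under `μ₋`, plus an integral over `𝒳₌`, where
parity imposes nothing and `f = η` is best. What remains is to minimize the total cost over pairs of
plans from `bp` and `bm` with a common second marginal.

Existence (`exists_optimal_pair`): for fixed `p`, `q` the minimum over `y` of `cost p y + cost q y`
is explicit, so the pair problem reduces to one transport problem between `bp` and `bm`, solved by
compactness and lower semicontinuity.

Maps (`exists_map_of_optimal`): at fixed `d` the cost is a multiple of `(h - y)²`, so the support of
an optimal plan is monotone in `h`. If `(h, d)` is sent to both sides of a rational `q`,
monotonicity leaves no other such `h` at level `d`. The points with several images thus lie on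
countably many graphs `h = F(d)`, which are null.

Uniqueness (`IsOptimalPair.exists_common_map`): total cost is linear, so the average of two optimal
pairs is optimal, and its plans are carried by graphs. Both original plans then lie on the same
graph, which identifies the marginals and the regression functions almost everywhere. -/

noncomputable section

namespace FairRegression

open Filter Topology BoundedContinuousFunction

/-! ### Compactness of transport plans, and gluing -/

section Existence

variable {α β γ : Type*} [MeasurableSpace α] [MeasurableSpace β] [MeasurableSpace γ]

theorem IsTransportPlan.isProbabilityMeasure {μ : Measure α} {ν : Measure β}
    [IsProbabilityMeasure μ] {π : Measure (α × β)} (h : IsTransportPlan μ ν π) :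
    IsProbabilityMeasure π := by
  constructor
  rw [← measure_univ (μ := μ), ← h.1, Measure.map_apply measurable_fst MeasurableSet.univ,
    Set.preimage_univ]

theorem IsTransportPlan.prod (μ : Measure α) (ν : Measure β) [IsProbabilityMeasure μ]
    [IsProbabilityMeasure ν] : IsTransportPlan μ ν (μ.prod ν) := by
  simp [IsTransportPlan, Measure.map_fst_prod, Measure.map_snd_prod]

theorem IsTransportPlan.OT_le {c : α → β → ℝ≥0∞} {μ : Measure α} {ν : Measure β}
    {π : Measure (α × β)} (h : IsTransportPlan μ ν π) : OT c μ ν ≤ ∫⁻ z, c z.1 z.2 ∂π :=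
  iInf₂_le π h

section Compactness

variable [TopologicalSpace α] [T2Space α] [SecondCountableTopology α] [BorelSpace α]
  [TopologicalSpace.IsCompletelyPseudoMetrizableSpace α]
  [TopologicalSpace β] [T2Space β] [SecondCountableTopology β] [BorelSpace β]
  [TopologicalSpace.IsCompletelyPseudoMetrizableSpace β]

/-- Taking marginals is weakly continuous, so the set is closed; both marginals are single tight
measures, so it is tight, and Prokhorov's theorem applies. -/
theorem isCompact_setOf_isTransportPlan [TopologicalSpace.PseudoMetrizableSpace α]
    [TopologicalSpace.PseudoMetrizableSpace β] (μ : Measure α) (ν : Measure β)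
    [IsProbabilityMeasure μ] [IsProbabilityMeasure ν] :
    IsCompact {π : ProbabilityMeasure (α × β) | IsTransportPlan μ ν (π : Measure (α × β))} := by
  have hclosed : IsClosed
      {π : ProbabilityMeasure (α × β) | IsTransportPlan μ ν (π : Measure (α × β))} := by
    have h1 := ProbabilityMeasure.continuous_map (Ω := α × β) continuous_fst
    have h2 := ProbabilityMeasure.continuous_map (Ω := α × β) continuous_snd
    let μ' : ProbabilityMeasure α := ⟨μ, inferInstance⟩
    let ν' : ProbabilityMeasure β := ⟨ν, inferInstance⟩
    have := ((isClosed_singleton (x := μ')).preimage h1).inter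
      ((isClosed_singleton (x := ν')).preimage h2)
    convert this using 1
    ext π
    exact and_congr ⟨fun h => Subtype.ext h, fun h => congrArg Subtype.val h⟩
      ⟨fun h => Subtype.ext h, fun h => congrArg Subtype.val h⟩
  rw [← hclosed.closure_eq]
  apply isCompact_closure_of_isTightMeasureSet
  apply IsTightMeasureSet.prodMk
  · refine (isTightMeasureSet_singleton (μ := μ)).subset ?_
    rintro _ ⟨_, ⟨π, hπ, rfl⟩, rfl⟩
    exact hπ.1
  · refine (isTightMeasureSet_singleton (μ := ν)).subset ?_
    rintro _ ⟨_, ⟨π, hπ, rfl⟩, rfl⟩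
    exact hπ.2

/-- Optimal plans exist for a cost that is the limit of an increasing sequence of bounded
continuous functions almost everywhere along every transport plan. -/
theorem exists_optimal_plan [TopologicalSpace.PseudoMetrizableSpace α]
    [TopologicalSpace.PseudoMetrizableSpace β] (μ : Measure α) (ν : Measure β)
    [IsProbabilityMeasure μ] [IsProbabilityMeasure ν] (c : α × β → ℝ≥0∞)
    (f : ℕ → α × β →ᵇ ℝ≥0) (hmono : ∀ z, Monotone fun n => f n z)
    (hf : ∀ π : Measure (α × β), IsTransportPlan μ ν π → ∀ᵐ z ∂π, ⨆ n, (f n z : ℝ≥0∞) = c z) :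
    ∃ π : Measure (α × β), IsTransportPlan μ ν π ∧
      ∀ π', IsTransportPlan μ ν π' → ∫⁻ z, c z ∂π ≤ ∫⁻ z, c z ∂π' := by
  have key : ∀ π : Measure (α × β), IsTransportPlan μ ν π →
      ∫⁻ z, c z ∂π = ⨆ n, ∫⁻ z, (f n z : ℝ≥0∞) ∂π := by
    intro π hπ
    rw [← lintegral_iSup]
    · exact lintegral_congr_ae ((hf π hπ).mono fun z hz => hz.symm)
    · exact fun n => (f n).continuous.measurable.coe_nnreal_ennreal
    · exact fun m n h z => ENNReal.coe_le_coe.2 (hmono z h)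
  have hlsc : LowerSemicontinuous fun π : ProbabilityMeasure (α × β) =>
      ⨆ n, ∫⁻ z, (f n z : ℝ≥0∞) ∂(π : Measure (α × β)) :=
    lowerSemicontinuous_iSup fun n =>
      (ProbabilityMeasure.continuous_lintegral_boundedContinuousFunction (f n)).lowerSemicontinuous
  obtain ⟨π, hπ, hmin⟩ := (hlsc.lowerSemicontinuousOn _).exists_isMinOn
    ⟨⟨μ.prod ν, inferInstance⟩, IsTransportPlan.prod μ ν⟩ (isCompact_setOf_isTransportPlan μ ν)
  refine ⟨π, hπ, fun π' hπ' => ?_⟩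
  have := hπ'.isProbabilityMeasure
  rw [key _ hπ, key _ hπ']
  exact hmin (a := ⟨π', this⟩) hπ'

end Compactness

/-- Two transport plans with a common second marginal can be glued along it. -/
theorem exists_gluing [StandardBorelSpace α] [StandardBorelSpace β] [Nonempty α] [Nonempty β]
    {μ : Measure α} {ν : Measure β} {ξ : Measure γ}
    [IsProbabilityMeasure μ] [IsProbabilityMeasure ν]
    {π : Measure (α × γ)} {ρ : Measure (β × γ)} (hπ : IsTransportPlan μ ξ π)
    (hρ : IsTransportPlan ν ξ ρ) :
    ∃ τ : Measure (γ × α × β), τ.map (fun z => (z.2.1, z.1)) = π ∧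
      τ.map (fun z => (z.2.2, z.1)) = ρ := by
  have := hπ.isProbabilityMeasure
  have := hρ.isProbabilityMeasure
  have h1 : (π.map Prod.swap).fst = ξ := by
    rw [Measure.fst_map_swap]; exact hπ.2
  have h2 : (ρ.map Prod.swap).fst = ξ := by
    rw [Measure.fst_map_swap]; exact hρ.2
  have : IsProbabilityMeasure ξ := by
    rw [← h1]
    have := Measure.isProbabilityMeasure_map (μ := π) measurable_swap.aemeasurable
    infer_instance
  have e1 := (π.map Prod.swap).disintegrate (π.map Prod.swap).condKernel
  have e2 := (ρ.map Prod.swap).disintegrate (ρ.map Prod.swap).condKernel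
  rw [h1] at e1
  rw [h2] at e2
  set κ := (π.map Prod.swap).condKernel
  set κ' := (ρ.map Prod.swap).condKernel
  -- The two first coordinates are made conditionally independent given the shared one.
  refine ⟨ξ ⊗ₘ (κ ×ₖ κ'), ?_, ?_⟩
  · have : π = (ξ ⊗ₘ κ).map Prod.swap := by
      rw [e1, Measure.map_map measurable_swap measurable_swap]; simp
    rw [this, show κ = (κ ×ₖ κ').map Prod.fst by rw [← Kernel.fst_eq, Kernel.fst_prod],
      Measure.compProd_map measurable_fst, Measure.map_map measurable_swap (by fun_prop),
      ← Kernel.fst_eq, Kernel.fst_prod]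
    rfl
  · have : ρ = (ξ ⊗ₘ κ').map Prod.swap := by
      rw [e2, Measure.map_map measurable_swap measurable_swap]; simp
    rw [this, show κ' = (κ ×ₖ κ').map Prod.snd by rw [← Kernel.snd_eq, Kernel.snd_prod],
      Measure.compProd_map measurable_snd, Measure.map_map measurable_swap (by fun_prop),
      ← Kernel.snd_eq, Kernel.snd_prod]
    rfl

end Existence

/-! ### Elimination of the common target point -/

section Cost

theorem cost_eq_ofReal {p : ℝ × ℝ} (hp : p.2 ≠ 0) (y : ℝ) :
    cost p y = ENNReal.ofReal ((p.1 - y) ^ 2 / |p.2|) := by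
  rw [cost, ENNReal.ofReal_div_of_pos (abs_pos.2 hp)]

theorem measurable_cost : Measurable fun z : (ℝ × ℝ) × ℝ => cost z.1 z.2 := by
  unfold cost
  fun_prop

theorem measurable_cost_comp {α : Type*} [MeasurableSpace α] {u : α → ℝ × ℝ} {v : α → ℝ}
    (hu : Measurable u) (hv : Measurable v) : Measurable fun x => cost (u x) (v x) := by
  unfold cost
  fun_prop

/-- The minimum over `y` of `cost p y + cost q y`. -/
def pairCost (p q : ℝ × ℝ) : ℝ := (p.1 - q.1) ^ 2 / (|p.2| + |q.2|)

/-- The point at which `cost p y + cost q y` is minimal. -/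
def pairPoint (p q : ℝ × ℝ) : ℝ := (|q.2| * p.1 + |p.2| * q.1) / (|p.2| + |q.2|)

theorem measurable_pairPoint : Measurable fun z : (ℝ × ℝ) × ℝ × ℝ => pairPoint z.1 z.2 := by
  unfold pairPoint
  fun_prop

/-- After clearing denominators the difference of the two sides is the square of `|q.2| (p.1 - y) +
|p.2| (q.1 - y)`, which vanishes at `y = pairPoint p q`. -/
theorem pairCost_le {p q : ℝ × ℝ} (hp : p.2 ≠ 0) (hq : q.2 ≠ 0) (y : ℝ) :
    ENNReal.ofReal (pairCost p q) ≤ cost p y + cost q y := by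
  rw [cost_eq_ofReal hp, cost_eq_ofReal hq, ← ENNReal.ofReal_add (by positivity) (by positivity)]
  apply ENNReal.ofReal_le_ofReal
  have ha := abs_pos.2 hp
  have hb := abs_pos.2 hq
  rw [pairCost, div_add_div _ _ ha.ne' hb.ne', div_le_div_iff₀ (by positivity) (by positivity)]
  nlinarith [sq_nonneg (|q.2| * (p.1 - y) + |p.2| * (q.1 - y))]

theorem cost_pairPoint {p q : ℝ × ℝ} (hp : p.2 ≠ 0) (hq : q.2 ≠ 0) :
    cost p (pairPoint p q) + cost q (pairPoint p q) = ENNReal.ofReal (pairCost p q) := by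
  rw [cost_eq_ofReal hp, cost_eq_ofReal hq, ← ENNReal.ofReal_add (by positivity) (by positivity)]
  congr 1
  have ha := abs_pos.2 hp
  have hb := abs_pos.2 hq
  rw [pairCost, pairPoint]
  field_simp
  ring

/-- Bounded continuous truncations of `pairCost`. -/
def truncCost (n : ℕ) : (ℝ × ℝ) × ℝ × ℝ →ᵇ ℝ≥0 :=
  BoundedContinuousFunction.mkOfBound
    ⟨fun z => (min (n : ℝ) ((z.1.1 - z.2.1) ^ 2 / (|z.1.2| + |z.2.2| + 1 / (n + 1)))).toNNReal, by
      refine continuous_real_toNNReal.comp (continuous_const.min ?_)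
      refine Continuous.div (by fun_prop) (by fun_prop) fun z => ?_
      positivity⟩ n (by
    intro z w
    have h : ∀ r : ℝ, (min (n : ℝ) r).toNNReal ≤ n := fun r =>
      Real.toNNReal_le_iff_le_coe.2 (by simp)
    rw [NNReal.dist_eq, abs_sub_le_iff]
    have h1 := NNReal.coe_le_coe.2
      (h ((z.1.1 - z.2.1) ^ 2 / (|z.1.2| + |z.2.2| + 1 / (n + 1))))
    have h2 := NNReal.coe_le_coe.2
      (h ((w.1.1 - w.2.1) ^ 2 / (|w.1.2| + |w.2.2| + 1 / (n + 1))))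
    have h3 := NNReal.coe_nonneg
      (min (n : ℝ) ((z.1.1 - z.2.1) ^ 2 / (|z.1.2| + |z.2.2| + 1 / (n + 1)))).toNNReal
    have h4 := NNReal.coe_nonneg
      (min (n : ℝ) ((w.1.1 - w.2.1) ^ 2 / (|w.1.2| + |w.2.2| + 1 / (n + 1)))).toNNReal
    rw [NNReal.coe_natCast] at h1 h2
    constructor
    · exact (sub_le_self _ h4).trans h1
    · exact (sub_le_self _ h3).trans h2)

theorem truncCost_apply (n : ℕ) (z : (ℝ × ℝ) × ℝ × ℝ) : truncCost n z =
    (min (n : ℝ) ((z.1.1 - z.2.1) ^ 2 / (|z.1.2| + |z.2.2| + 1 / (n + 1)))).toNNReal := rfl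

theorem monotone_truncCost (z : (ℝ × ℝ) × ℝ × ℝ) : Monotone fun n => truncCost n z := by
  intro m n h
  have h' : (m : ℝ) ≤ n := by exact_mod_cast h
  simp only [truncCost_apply]
  gcongr

/-- The term `1 / (n + 1)` keeps the truncations continuous where both weights vanish. Only the
first weight has to be nonzero, so that the second point may be `(y, 0)`, for which `pairCost`
becomes the original cost. -/
theorem iSup_truncCost {z : (ℝ × ℝ) × ℝ × ℝ} (h1 : z.1.2 ≠ 0) :
    ⨆ n, (truncCost n z : ℝ≥0∞) = ENNReal.ofReal (pairCost z.1 z.2) := by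
  refine iSup_eq_of_tendsto (fun m n h => ENNReal.coe_le_coe.2 (monotone_truncCost z h)) ?_
  have hb : 0 < |z.1.2| + |z.2.2| := by
    have := abs_pos.2 h1
    positivity
  have hlim : Tendsto (fun n : ℕ => (z.1.1 - z.2.1) ^ 2 / (|z.1.2| + |z.2.2| + 1 / ((n : ℝ) + 1)))
      atTop (𝓝 (pairCost z.1 z.2)) := by
    refine Tendsto.div tendsto_const_nhds ?_ hb.ne'
    simpa using tendsto_one_div_add_atTop_nhds_zero_nat.const_add (|z.1.2| + |z.2.2|)
  refine (ENNReal.tendsto_ofReal hlim).congr' ?_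
  obtain ⟨N, hN⟩ := exists_nat_ge (pairCost z.1 z.2)
  filter_upwards [eventually_ge_atTop N] with n hn
  rw [truncCost_apply, ENNReal.ofReal, min_eq_right]
  refine le_trans ?_ (hN.trans (by exact_mod_cast hn))
  rw [pairCost]
  have : (0 : ℝ) < 1 / (n + 1) := by positivity
  exact div_le_div_of_nonneg_left (sq_nonneg _) hb (by linarith)

/-- There is a pair of transport plans with a common second marginal of least total cost. -/
theorem exists_optimal_pair {bp bm : Measure (ℝ × ℝ)} [IsProbabilityMeasure bp]
    [IsProbabilityMeasure bm] (hp : ∀ᵐ p ∂bp, p.2 ≠ 0) (hm : ∀ᵐ p ∂bm, p.2 ≠ 0) :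
    ∃ (ν : Measure ℝ) (πp πm : Measure ((ℝ × ℝ) × ℝ)),
      IsProbabilityMeasure ν ∧ IsTransportPlan bp ν πp ∧ IsTransportPlan bm ν πm ∧
      ∀ (ν' : Measure ℝ) (πp' πm' : Measure ((ℝ × ℝ) × ℝ)),
        IsTransportPlan bp ν' πp' → IsTransportPlan bm ν' πm' →
        ∫⁻ z, cost z.1 z.2 ∂πp + ∫⁻ z, cost z.1 z.2 ∂πm ≤
          ∫⁻ z, cost z.1 z.2 ∂πp' + ∫⁻ z, cost z.1 z.2 ∂πm' := by
  have hne : ∀ τ : Measure ((ℝ × ℝ) × ℝ × ℝ), IsTransportPlan bp bm τ →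
      ∀ᵐ z ∂τ, z.1.2 ≠ 0 ∧ z.2.2 ≠ 0 := by
    intro τ hτ
    have h1 := ae_of_ae_map measurable_fst.aemeasurable (hτ.1.symm ▸ hp)
    have h2 := ae_of_ae_map measurable_snd.aemeasurable (hτ.2.symm ▸ hm)
    filter_upwards [h1, h2] with z h1 h2 using ⟨h1, h2⟩
  obtain ⟨τ, hτ, hmin⟩ := exists_optimal_plan bp bm
    (fun z => ENNReal.ofReal (pairCost z.1 z.2)) truncCost monotone_truncCost
    fun τ hτ => (hne τ hτ).mono fun z hz => iSup_truncCost hz.1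
  have := hτ.isProbabilityMeasure
  have hy := measurable_pairPoint
  -- An optimal coupling `τ` of `bp` and `bm` sends both ends of each pair to their best meeting
  -- point.
  refine ⟨τ.map fun z => pairPoint z.1 z.2, τ.map fun z => (z.1, pairPoint z.1 z.2),
    τ.map fun z => (z.2, pairPoint z.1 z.2), Measure.isProbabilityMeasure_map hy.aemeasurable,
    ⟨?_, ?_⟩, ⟨?_, ?_⟩, ?_⟩
  · rw [Measure.map_map measurable_fst (by fun_prop)]; exact hτ.1
  · rw [Measure.map_map measurable_snd (by fun_prop)]; rfl
  · rw [Measure.map_map measurable_fst (by fun_prop)]; exact hτ.2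
  · rw [Measure.map_map measurable_snd (by fun_prop)]; rfl
  intro ν' πp' πm' hp' hm'
  rw [lintegral_map measurable_cost (by fun_prop), lintegral_map measurable_cost (by fun_prop),
    ← lintegral_add_left (measurable_cost_comp measurable_fst hy)]
  -- Gluing the competitors along their common marginal yields a coupling of `bp` and `bm`, whose
  -- `pairCost` is at most the total cost of the competitors.
  obtain ⟨σ, rfl, rfl⟩ := exists_gluing hp' hm'
  have hσ : IsTransportPlan bp bm (σ.map Prod.snd) := by
    constructor
    · rw [← hp'.1, Measure.map_map measurable_fst measurable_snd,
        Measure.map_map measurable_fst (by fun_prop)]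
      rfl
    · rw [← hm'.1, Measure.map_map measurable_snd measurable_snd,
        Measure.map_map measurable_fst (by fun_prop)]
      rfl
  calc _ = ∫⁻ z, ENNReal.ofReal (pairCost z.1 z.2) ∂τ :=
        lintegral_congr_ae ((hne τ hτ).mono fun z hz => cost_pairPoint hz.1 hz.2)
    _ ≤ ∫⁻ z, ENNReal.ofReal (pairCost z.1 z.2) ∂(σ.map Prod.snd) := hmin _ hσ
    _ = ∫⁻ z, ENNReal.ofReal (pairCost z.2.1 z.2.2) ∂σ := by
        rw [lintegral_map (by unfold pairCost; fun_prop) measurable_snd]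
    _ ≤ ∫⁻ z, cost z.2.1 z.1 + cost z.2.2 z.1 ∂σ :=
        lintegral_mono_ae ((ae_of_ae_map measurable_snd.aemeasurable (hne _ hσ)).mono
          fun z hz => pairCost_le hz.1 hz.2 _)
    _ = _ := by
        rw [lintegral_map measurable_cost (by fun_prop),
          lintegral_map measurable_cost (by fun_prop),
          ← lintegral_add_left (measurable_cost_comp (by fun_prop) (by fun_prop))]

end Cost

/-! ### Monotonicity of optimal plans -/

section Monotonicity

variable {α β : Type*} [MeasurableSpace α] [MeasurableSpace β]

/-- Two-point cyclical monotonicity, in terms of blocks of positive mass: equal amounts of mass in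
`U × V` and `U' × V'` are rerouted to `U × V'` and `U' × V` without changing the marginals, and
optimality forbids a gain. -/
theorem swap_not_improving {c : α → β → ℝ≥0∞} {μ : Measure α} {ν : Measure β}
    {π : Measure (α × β)} [IsProbabilityMeasure π]
    (hπ : IsTransportPlan μ ν π) (hopt : ∫⁻ z, c z.1 z.2 ∂π = OT c μ ν) (hfin : OT c μ ν ≠ ∞)
    {U U' : Set α} {V V' : Set β} (hU : MeasurableSet U) (hU' : MeasurableSet U')
    (hV : MeasurableSet V) (hV' : MeasurableSet V') (hVV' : Disjoint V V')
    (h0 : π (U ×ˢ V) ≠ 0) (h0' : π (U' ×ˢ V') ≠ 0) {A A' B B' : ℝ≥0∞}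
    (hA : ∀ x ∈ U, ∀ y ∈ V, A ≤ c x y) (hA' : ∀ x ∈ U', ∀ y ∈ V', A' ≤ c x y)
    (hB : ∀ x ∈ U, ∀ y ∈ V', c x y ≤ B) (hB' : ∀ x ∈ U', ∀ y ∈ V, c x y ≤ B') :
    A + A' ≤ B + B' := by
  set W := U ×ˢ V
  set W' := U' ×ˢ V'
  have hW : MeasurableSet W := hU.prod hV
  have hW' : MeasurableSet W' := hU'.prod hV'
  have hWW' : Disjoint W W' := Set.Disjoint.set_prod_right hVV' U U'
  set σ := cond π W
  set σ' := cond π W'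
  have : IsProbabilityMeasure σ := cond_isProbabilityMeasure h0
  have : IsProbabilityMeasure σ' := cond_isProbabilityMeasure h0'
  have hσ : ∀ᵐ z ∂σ, z ∈ W := ae_cond_mem hW
  have hσ' : ∀ᵐ z ∂σ', z ∈ W' := ae_cond_mem hW'
  -- The largest mass that can be taken from both blocks; `R` is what stays in place.
  set ε := min (π W) (π W')
  have hε : ε ≠ 0 := by
    rcases min_choice (π W) (π W') with h | h <;> simp only [ε, h] <;> assumption
  have hε' : ε ≠ ∞ := ne_top_of_le_ne_top (measure_ne_top π W) (min_le_left _ _)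
  set R := π.restrict (W ∪ W')ᶜ + (π W - ε) • σ + (π W' - ε) • σ'
  have e1 : π.restrict W = (π W - ε) • σ + ε • σ := by
    rw [← add_smul, tsub_add_cancel_of_le (min_le_left _ _)]
    simp only [σ, ProbabilityTheory.cond]
    rw [smul_smul, ENNReal.mul_inv_cancel h0 (measure_ne_top _ _), one_smul]
  have e2 : π.restrict W' = (π W' - ε) • σ' + ε • σ' := by
    rw [← add_smul, tsub_add_cancel_of_le (min_le_right _ _)]
    simp only [σ', ProbabilityTheory.cond]
    rw [smul_smul, ENNReal.mul_inv_cancel h0' (measure_ne_top _ _), one_smul]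
  have hdec : π = R + ε • (σ + σ') := by
    conv_lhs => rw [← Measure.restrict_add_restrict_compl (μ := π) (hW.union hW'),
      Measure.restrict_union hWW' hW', e1, e2]
    simp only [R, smul_add]
    abel
  -- The exchanged mass: the sources of one block are coupled independently with the targets of the
  -- other.
  set τ := σ.fst.prod σ'.snd
  set τ' := σ'.fst.prod σ.snd
  have hσU : ∀ᵐ x ∂σ.fst, x ∈ U :=
    (ae_map_iff measurable_fst.aemeasurable hU).2 (hσ.mono fun z hz => hz.1)
  have hσU' : ∀ᵐ x ∂σ'.fst, x ∈ U' :=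
    (ae_map_iff measurable_fst.aemeasurable hU').2 (hσ'.mono fun z hz => hz.1)
  have hσV : ∀ᵐ x ∂σ.snd, x ∈ V :=
    (ae_map_iff measurable_snd.aemeasurable hV).2 (hσ.mono fun z hz => hz.2)
  have hσV' : ∀ᵐ x ∂σ'.snd, x ∈ V' :=
    (ae_map_iff measurable_snd.aemeasurable hV').2 (hσ'.mono fun z hz => hz.2)
  have hτ : ∫⁻ z, c z.1 z.2 ∂τ ≤ B := by
    calc _ ≤ ∫⁻ _, B ∂τ := by
          apply lintegral_mono_ae
          filter_upwards [Measure.quasiMeasurePreserving_fst.ae hσU,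
            Measure.quasiMeasurePreserving_snd.ae hσV'] with z h1 h2 using hB _ h1 _ h2
      _ = B := by simp
  have hτ' : ∫⁻ z, c z.1 z.2 ∂τ' ≤ B' := by
    calc _ ≤ ∫⁻ _, B' ∂τ' := by
          apply lintegral_mono_ae
          filter_upwards [Measure.quasiMeasurePreserving_fst.ae hσU',
            Measure.quasiMeasurePreserving_snd.ae hσV] with z h1 h2 using hB' _ h1 _ h2
      _ = B' := by simp
  have hAσ : A ≤ ∫⁻ z, c z.1 z.2 ∂σ := by
    calc A = ∫⁻ _, A ∂σ := by simp
      _ ≤ _ := lintegral_mono_ae (hσ.mono fun z hz => hA _ hz.1 _ hz.2)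
  have hAσ' : A' ≤ ∫⁻ z, c z.1 z.2 ∂σ' := by
    calc A' = ∫⁻ _, A' ∂σ' := by simp
      _ ≤ _ := lintegral_mono_ae (hσ'.mono fun z hz => hA' _ hz.1 _ hz.2)
  have hplan : IsTransportPlan μ ν (R + ε • (τ + τ')) := by
    constructor
    · have h1 : τ.map Prod.fst = σ.map Prod.fst := Measure.fst_prod
      have h2 : τ'.map Prod.fst = σ'.map Prod.fst := Measure.fst_prod
      rw [← hπ.1]
      conv_rhs => rw [hdec]
      simp only [Measure.map_add _ _ measurable_fst, Measure.map_smul, h1, h2]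
    · have h1 : τ.map Prod.snd = σ'.map Prod.snd := Measure.snd_prod
      have h2 : τ'.map Prod.snd = σ.map Prod.snd := Measure.snd_prod
      rw [← hπ.2]
      conv_rhs => rw [hdec]
      simp only [Measure.map_add _ _ measurable_snd, Measure.map_smul, h1, h2]
      rw [add_comm (σ.map Prod.snd)]
  have hle := hplan.OT_le (c := c)
  rw [← hopt] at hle hfin
  rw [hdec] at hle hfin
  simp only [lintegral_add_measure _ _ _, lintegral_smul_measure, smul_eq_mul] at hle hfin
  have hR := (ENNReal.add_ne_top.1 hfin).1
  have := (ENNReal.mul_le_mul_iff_right hε hε').1 ((ENNReal.add_le_add_iff_left hR).1 hle)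
  exact (add_le_add hAσ hAσ').trans (this.trans (add_le_add hτ hτ'))

end Monotonicity

theorem continuousAt_sq_div {p : ℝ × ℝ} (hp : p.2 ≠ 0) (y : ℝ) :
    ContinuousAt (fun z : (ℝ × ℝ) × ℝ => (z.1.1 - z.2) ^ 2 / |z.1.2|) (p, y) :=
  ContinuousAt.div (by fun_prop) (by fun_prop) (abs_ne_zero.2 hp)

/-- On each level of `d`, the support of an optimal plan is monotone. -/
theorem monotone_support {b : Measure (ℝ × ℝ)} {ν : Measure ℝ} {π : Measure ((ℝ × ℝ) × ℝ)}
    [IsProbabilityMeasure π] (hπ : IsTransportPlan b ν π)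
    (hopt : ∫⁻ z, cost z.1 z.2 ∂π = OT cost b ν) (hfin : OT cost b ν ≠ ∞)
    {h h' d y y' : ℝ} (hd : d ≠ 0) (hz : ((h, d), y) ∈ π.support)
    (hz' : ((h', d), y') ∈ π.support) (hh : h < h') : y ≤ y' := by
  by_contra! hy
  set k : (ℝ × ℝ) × ℝ → ℝ := fun z => (z.1.1 - z.2) ^ 2 / |z.1.2| with hk
  -- The gap equals `2 (h' - h) (y - y') / |d|`.
  have hgap : k ((h, d), y') + k ((h', d), y) < k ((h, d), y) + k ((h', d), y') := by
    simp only [hk, ← add_div]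
    refine div_lt_div_of_pos_right ?_ (abs_pos.2 hd)
    nlinarith [mul_pos (sub_pos.2 hh) (sub_pos.2 hy)]
  -- The four costs each vary by less than `ε` near their points, so the gap `8 ε` survives a total
  -- error of `4 ε`.
  set ε := (k ((h, d), y) + k ((h', d), y') - k ((h, d), y') - k ((h', d), y)) / 8 with hε
  have hε0 : 0 < ε := by linarith
  have ev : ∀ (p : ℝ × ℝ) (s : ℝ), p.2 ≠ 0 → ∃ U ∈ 𝓝 p, ∃ V ∈ 𝓝 s, ∀ x ∈ U, ∀ t ∈ V,
      x.2 ≠ 0 ∧ |k (x, t) - k (p, s)| < ε := by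
    intro p s hp
    have h1 : ∀ᶠ z in 𝓝 (p, s), |k z - k (p, s)| < ε := by
      have := Metric.tendsto_nhds.1 (continuousAt_sq_div hp s) ε hε0
      exact this
    have h2 : ∀ᶠ z : (ℝ × ℝ) × ℝ in 𝓝 (p, s), z.1.2 ≠ 0 := by
      have : ContinuousAt (fun z : (ℝ × ℝ) × ℝ => z.1.2) (p, s) := by fun_prop
      exact this.eventually_ne hp
    obtain ⟨U, hU, V, hV, hUV⟩ := mem_nhds_prod_iff.1 (h1.and h2)
    exact ⟨U, hU, V, hV, fun x hx t ht =>
      ⟨(hUV (Set.mk_mem_prod hx ht)).2, (hUV (Set.mk_mem_prod hx ht)).1⟩⟩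
  obtain ⟨U1, hU1, V1, hV1, H1⟩ := ev (h, d) y hd
  obtain ⟨U2, hU2, V2, hV2, H2⟩ := ev (h, d) y' hd
  obtain ⟨U3, hU3, V3, hV3, H3⟩ := ev (h', d) y hd
  obtain ⟨U4, hU4, V4, hV4, H4⟩ := ev (h', d) y' hd
  obtain ⟨N, N', hN, hN', hyN, hyN', hNN'⟩ := t2_separation hy.ne'
  obtain ⟨U, hUs, hUo, hUm⟩ := mem_nhds_iff.1 (inter_mem hU1 hU2)
  obtain ⟨U', hUs', hUo', hUm'⟩ := mem_nhds_iff.1 (inter_mem hU3 hU4)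
  obtain ⟨V, hVs, hVo, hVm⟩ := mem_nhds_iff.1 (inter_mem (inter_mem hV1 hV3) (hN.mem_nhds hyN))
  obtain ⟨V', hVs', hVo', hVm'⟩ :=
    mem_nhds_iff.1 (inter_mem (inter_mem hV2 hV4) (hN'.mem_nhds hyN'))
  have hpos : π (U ×ˢ V) ≠ 0 :=
    (((Measure.mem_support_iff_forall _).1 hz) _
      ((hUo.prod hVo).mem_nhds (Set.mk_mem_prod hUm hVm))).ne'
  have hpos' : π (U' ×ˢ V') ≠ 0 :=
    (((Measure.mem_support_iff_forall _).1 hz') _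
      ((hUo'.prod hVo').mem_nhds (Set.mk_mem_prod hUm' hVm'))).ne'
  have key := swap_not_improving hπ hopt hfin hUo.measurableSet hUo'.measurableSet
    hVo.measurableSet hVo'.measurableSet
    (hNN'.mono (fun t ht => (hVs ht).2) (fun t ht => (hVs' ht).2)) hpos hpos'
    (A := ENNReal.ofReal (k ((h, d), y) - ε)) (A' := ENNReal.ofReal (k ((h', d), y') - ε))
    (B := ENNReal.ofReal (k ((h, d), y') + ε)) (B' := ENNReal.ofReal (k ((h', d), y) + ε))
    (fun x hx t ht => by
      obtain ⟨h1, h2⟩ := H1 x (hUs hx).1 t (hVs ht).1.1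
      rw [cost_eq_ofReal h1]
      exact ENNReal.ofReal_le_ofReal (by rw [abs_lt] at h2; simp only [hk] at h2 ⊢; linarith))
    (fun x hx t ht => by
      obtain ⟨h1, h2⟩ := H4 x (hUs' hx).2 t (hVs' ht).1.2
      rw [cost_eq_ofReal h1]
      exact ENNReal.ofReal_le_ofReal (by rw [abs_lt] at h2; simp only [hk] at h2 ⊢; linarith))
    (fun x hx t ht => by
      obtain ⟨h1, h2⟩ := H2 x (hUs hx).2 t (hVs' ht).1.1
      rw [cost_eq_ofReal h1]
      exact ENNReal.ofReal_le_ofReal (by rw [abs_lt] at h2; simp only [hk] at h2 ⊢; linarith))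
    (fun x hx t ht => by
      obtain ⟨h1, h2⟩ := H3 x (hUs' hx).1 t (hVs ht).1.2
      rw [cost_eq_ofReal h1]
      exact ENNReal.ofReal_le_ofReal (by rw [abs_lt] at h2; simp only [hk] at h2 ⊢; linarith))
  have hk0 : ∀ z, 0 ≤ k z := fun z => by simp only [hk]; positivity
  have hsum : ENNReal.ofReal (k ((h, d), y') + ε) + ENNReal.ofReal (k ((h', d), y) + ε) =
      ENNReal.ofReal (k ((h, d), y') + ε + (k ((h', d), y) + ε)) :=
    (ENNReal.ofReal_add (add_nonneg (hk0 _) hε0.le) (add_nonneg (hk0 _) hε0.le)).symm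
  rw [hsum] at key
  -- The lower bounds `k - ε` may be negative, so only subadditivity of `ENNReal.ofReal` is
  -- available on this side.
  have := ENNReal.ofReal_add_le.trans key
  rw [ENNReal.ofReal_le_ofReal_iff
    (by linarith [hk0 ((h, d), y'), hk0 ((h', d), y)])] at this
  linarith

/-! ### From monotone supports to transport maps -/

section Selection

/-- A Borel set whose vertical sections have at most one point lies on a measurable graph. -/
theorem exists_measurable_graph {α β : Type*} [MeasurableSpace α] [MeasurableSpace β]
    [StandardBorelSpace α] [StandardBorelSpace β] [Nonempty β] {G : Set (α × β)}
    (hG : MeasurableSet G) (hinj : ∀ z ∈ G, ∀ w ∈ G, z.1 = w.1 → z.2 = w.2) :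
    ∃ T : α → β, Measurable T ∧ ∀ z ∈ G, z.2 = T z.1 := by
  have := hG.standardBorel
  have hemb : MeasurableEmbedding fun z : G => (z : α × β).1 :=
    (measurable_fst.comp measurable_subtype_coe).measurableEmbedding fun z w h =>
      Subtype.ext (Prod.ext h (hinj z z.2 w w.2 h))
  obtain ⟨T, hT, hTG⟩ := hemb.exists_measurable_extend
    (measurable_snd.comp (measurable_subtype_coe (p := (· ∈ G)))) fun _ => inferInstance
  exact ⟨T, hT, fun z hz => (congrFun hTG ⟨z, hz⟩ :).symm⟩

/-- Projections of Borel sets need not be Borel, but an open set is a countable union of closed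
sets, so `C ∩ U` is σ-compact and so is its image. -/
theorem measurableSet_fst_image {C U : Set ((ℝ × ℝ) × ℝ)} (hC : IsClosed C) (hU : IsOpen U) :
    MeasurableSet (Prod.fst '' (C ∩ U)) := by
  obtain ⟨F, hF, -, hFU, -⟩ := hU.exists_iUnion_isClosed
  rw [← hFU, Set.inter_iUnion]
  obtain ⟨K, hK, hKe⟩ := (isSigmaCompact_iUnion _ fun n =>
    isSigmaCompact_univ.of_isClosed_subset (hC.inter (hF n)) (Set.subset_univ _)).image
    (continuous_fst (X := ℝ × ℝ) (Y := ℝ))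
  rw [← hKe]
  exact MeasurableSet.iUnion fun n => (hK n).measurableSet

/-- An optimal plan from a measure that does not charge graphs is concentrated on the graph of a
measurable map. -/
theorem exists_map_of_optimal {b : Measure (ℝ × ℝ)} {ν : Measure ℝ} {π : Measure ((ℝ × ℝ) × ℝ)}
    [IsProbabilityMeasure b] (hπ : IsTransportPlan b ν π)
    (hopt : ∫⁻ z, cost z.1 z.2 ∂π = OT cost b ν) (hfin : OT cost b ν ≠ ∞)
    (hb : ∀ᵐ p ∂b, p.2 ≠ 0) (hg : NullOnGraphs b) :
    ∃ T : ℝ × ℝ → ℝ, Measurable T ∧ ∀ᵐ z ∂π, z.2 = T z.1 := by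
  have := hπ.isProbabilityMeasure
  have hmono : ∀ {h h' d y y' : ℝ}, d ≠ 0 → ((h, d), y) ∈ π.support →
      ((h', d), y') ∈ π.support → h < h' → y ≤ y' := fun hd hz hz' hh =>
    monotone_support hπ hopt hfin hd hz hz' hh
  have hopen : IsOpen {z : (ℝ × ℝ) × ℝ | z.1.2 ≠ 0} :=
    isOpen_ne_fun (by fun_prop) continuous_const
  have hlt : ∀ q : ℝ, IsOpen {z : (ℝ × ℝ) × ℝ | z.2 < q} := fun q =>
    isOpen_lt (by fun_prop) continuous_const
  have hgt : ∀ q : ℝ, IsOpen {z : (ℝ × ℝ) × ℝ | q < z.2} := fun q =>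
    isOpen_lt continuous_const (by fun_prop)
  -- `L q` and `M q` collect the points having an image below, respectively above, `q`; a point with
  -- two images lies in `L q ∩ M q` for some rational `q`.
  set L : ℚ → Set (ℝ × ℝ) := fun q =>
    Prod.fst '' (π.support ∩ ({z | z.1.2 ≠ 0} ∩ {z | z.2 < (q : ℝ)}))
  set M : ℚ → Set (ℝ × ℝ) := fun q =>
    Prod.fst '' (π.support ∩ ({z | z.1.2 ≠ 0} ∩ {z | (q : ℝ) < z.2}))
  have hLM : ∀ q, MeasurableSet (L q ∩ M q) := fun q =>
    (measurableSet_fst_image Measure.isClosed_support (hopen.inter (hlt q))).inter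
      (measurableSet_fst_image Measure.isClosed_support (hopen.inter (hgt q)))
  have hnull : ∀ q, b (L q ∩ M q) = 0 := by
    intro q
    -- If `h < h'`, an image of `h` above `q` and an image of `h'` below `q` contradict
    -- monotonicity. By symmetry each level `d` carries at most one `h`.
    have hsec : ∀ h h' d : ℝ, (h, d) ∈ L q ∩ M q → (h', d) ∈ L q ∩ M q → h' ≤ h := by
      rintro h h' d ⟨-, ⟨⟨⟨h1, d1⟩, y⟩, ⟨hz, hd, hy⟩, he⟩⟩ ⟨⟨⟨⟨h2, d2⟩, y'⟩, ⟨hz', -, hy'⟩, he'⟩, -⟩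
      simp only [Prod.mk.injEq] at he he'
      obtain ⟨rfl, rfl⟩ := he
      obtain ⟨rfl, rfl⟩ := he'
      by_contra! hlt
      have h5 := hmono hd hz hz' hlt
      exact absurd (lt_trans hy' hy : y' < y) (not_lt.2 h5)
    obtain ⟨F, hF, hFG⟩ := exists_measurable_graph (G := Prod.swap ⁻¹' (L q ∩ M q))
      (measurable_swap (hLM q)) (by
        rintro ⟨d, h⟩ hz ⟨d', h'⟩ hw he
        obtain rfl : d = d' := he
        exact le_antisymm (hsec _ _ _ hw hz) (hsec _ _ _ hz hw))
    refine measure_mono_null ?_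
      (hg (fun d => F d) (hF.comp measurable_subtype_coe))
    rintro ⟨h, d⟩ hz
    have hd : d ≠ 0 := by
      obtain ⟨w, ⟨-, hw, -⟩, he⟩ := hz.1
      have : w.1.2 ≠ 0 := hw
      rwa [he] at this
    exact ⟨⟨d, hd⟩, Prod.ext (hFG (d, h) hz).symm rfl⟩
  set N : Set (ℝ × ℝ) := ⋃ q, L q ∩ M q
  have hN : MeasurableSet N := MeasurableSet.iUnion hLM
  have hbN : b N = 0 := measure_iUnion_null hnull
  have hG : MeasurableSet ((π.support ∩ {z | z.1.2 ≠ 0}) \ Prod.fst ⁻¹' N) :=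
    (Measure.isClosed_support.measurableSet.inter hopen.measurableSet).diff (measurable_fst hN)
  have hle : ∀ (p : ℝ × ℝ) (y y' : ℝ), (p, y) ∈ π.support → (p, y') ∈ π.support → p.2 ≠ 0 →
      p ∉ N → y' ≤ y := by
    intro p y y' hy hy' hp hpN
    by_contra! hlt
    obtain ⟨q, hq, hq'⟩ := exists_rat_btwn hlt
    exact hpN (Set.mem_iUnion.2 ⟨q, ⟨_, ⟨hy, hp, hq⟩, rfl⟩, ⟨_, ⟨hy', hp, hq'⟩, rfl⟩⟩)
  obtain ⟨T, hT, hTG⟩ := exists_measurable_graph hG (by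
    rintro ⟨p, y⟩ ⟨⟨hz, hd⟩, hzN⟩ ⟨p', y'⟩ ⟨⟨hw, -⟩, -⟩ he
    obtain rfl : p = p' := he
    exact le_antisymm (hle p y' y hw hz hd hzN) (hle p y y' hz hw hd hzN))
  refine ⟨T, hT, ?_⟩
  have h1 : ∀ᵐ z ∂π, z.1.2 ≠ 0 := ae_of_ae_map measurable_fst.aemeasurable (hπ.1.symm ▸ hb)
  have h2 : ∀ᵐ z ∂π, z.1 ∉ N := by
    have : ∀ᵐ p ∂b, p ∉ N := measure_eq_zero_iff_ae_notMem.1 hbN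
    exact ae_of_ae_map measurable_fst.aemeasurable (hπ.1.symm ▸ this)
  filter_upwards [h1, h2, Measure.support_mem_ae (μ := π)] with z h1 h2 h3
  exact hTG z ⟨⟨h3, h1⟩, h2⟩

end Selection

/-! ### Optimal pairs of plans and barycenters -/

section Barycenter

/-- The total cost of a pair of transport plans. -/
def pairTotal (πp πm : Measure ((ℝ × ℝ) × ℝ)) : ℝ≥0∞ :=
  ∫⁻ z, cost z.1 z.2 ∂πp + ∫⁻ z, cost z.1 z.2 ∂πm

/-- A pair of plans with common second marginal `ν` of least total cost among all such pairs,
for all possible `ν`. -/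
structure IsOptimalPair (bp bm : Measure (ℝ × ℝ)) (ν : Measure ℝ)
    (πp πm : Measure ((ℝ × ℝ) × ℝ)) : Prop where
  plan_pos : IsTransportPlan bp ν πp
  plan_neg : IsTransportPlan bm ν πm
  le_pairTotal : ∀ (ν' : Measure ℝ) (πp' πm' : Measure ((ℝ × ℝ) × ℝ)),
    IsTransportPlan bp ν' πp' → IsTransportPlan bm ν' πm' → pairTotal πp πm ≤ pairTotal πp' πm'

variable {bp bm : Measure (ℝ × ℝ)} {ν ν' : Measure ℝ} {πp πm πp' πm' : Measure ((ℝ × ℝ) × ℝ)}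

theorem IsTransportPlan.isProbabilityMeasure_right {α β : Type*} [MeasurableSpace α]
    [MeasurableSpace β] {μ : Measure α} {ν : Measure β} [IsProbabilityMeasure μ]
    {π : Measure (α × β)} (h : IsTransportPlan μ ν π) : IsProbabilityMeasure ν := by
  have := h.isProbabilityMeasure
  rw [← h.2]
  exact Measure.isProbabilityMeasure_map measurable_snd.aemeasurable

theorem IsTransportPlan.average {α β : Type*} [MeasurableSpace α] [MeasurableSpace β]
    {μ : Measure α} {ν ν' : Measure β} {π π' : Measure (α × β)} (h : IsTransportPlan μ ν π)
    (h' : IsTransportPlan μ ν' π') :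
    IsTransportPlan μ ((2⁻¹ : ℝ≥0∞) • (ν + ν')) ((2⁻¹ : ℝ≥0∞) • (π + π')) := by
  constructor
  · rw [Measure.map_smul, Measure.map_add _ _ measurable_fst, h.1, h'.1, smul_add, ← add_smul,
      ENNReal.inv_two_add_inv_two, one_smul]
  · rw [Measure.map_smul, Measure.map_add _ _ measurable_snd, h.2, h'.2]

theorem IsOptimalPair.symm (h : IsOptimalPair bp bm ν πp πm) : IsOptimalPair bm bp ν πm πp where
  plan_pos := h.plan_neg
  plan_neg := h.plan_pos
  le_pairTotal ν' πp' πm' hp hm := by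
    have := h.le_pairTotal ν' πm' πp' hm hp
    rw [pairTotal, pairTotal] at this ⊢
    rwa [add_comm, add_comm (lintegral πp' _)]

theorem IsOptimalPair.pairTotal_eq (h : IsOptimalPair bp bm ν πp πm)
    (h' : IsOptimalPair bp bm ν' πp' πm') : pairTotal πp πm = pairTotal πp' πm' :=
  le_antisymm (h.le_pairTotal _ _ _ h'.plan_pos h'.plan_neg)
    (h'.le_pairTotal _ _ _ h.plan_pos h.plan_neg)

theorem IsOptimalPair.of_pairTotal_le (h : IsOptimalPair bp bm ν πp πm)
    (hp : IsTransportPlan bp ν' πp') (hm : IsTransportPlan bm ν' πm')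
    (hle : pairTotal πp' πm' ≤ pairTotal πp πm) : IsOptimalPair bp bm ν' πp' πm' :=
  ⟨hp, hm, fun _ _ _ h1 h2 => hle.trans (h.le_pairTotal _ _ _ h1 h2)⟩

theorem IsOptimalPair.average (h : IsOptimalPair bp bm ν πp πm)
    (h' : IsOptimalPair bp bm ν' πp' πm') :
    IsOptimalPair bp bm ((2⁻¹ : ℝ≥0∞) • (ν + ν')) ((2⁻¹ : ℝ≥0∞) • (πp + πp'))
      ((2⁻¹ : ℝ≥0∞) • (πm + πm')) := by
  refine h.of_pairTotal_le (h.plan_pos.average h'.plan_pos) (h.plan_neg.average h'.plan_neg) ?_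
  have e : pairTotal ((2⁻¹ : ℝ≥0∞) • (πp + πp')) ((2⁻¹ : ℝ≥0∞) • (πm + πm')) =
      2⁻¹ * (pairTotal πp πm + pairTotal πp' πm') := by
    simp only [pairTotal, lintegral_smul_measure, lintegral_add_measure, smul_eq_mul]
    ring
  rw [e, ← h.pairTotal_eq h', mul_add, ← add_mul, ENNReal.inv_two_add_inv_two, one_mul]

/-- Only the first plan is varied, with `ν` fixed; the finite cost of the second plan cancels. -/
theorem IsOptimalPair.lintegral_eq_OT (h : IsOptimalPair bp bm ν πp πm)
    (hfin : pairTotal πp πm ≠ ∞) : ∫⁻ z, cost z.1 z.2 ∂πp = OT cost bp ν := by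
  refine le_antisymm (le_iInf₂ fun π hπ => ?_) h.plan_pos.OT_le
  exact (ENNReal.add_le_add_iff_right (ENNReal.add_ne_top.1 hfin).2).1
    (h.le_pairTotal ν π πm hπ h.plan_neg)

theorem IsOptimalPair.lintegral_eq_OT' (h : IsOptimalPair bp bm ν πp πm)
    (hfin : pairTotal πp πm ≠ ∞) : ∫⁻ z, cost z.1 z.2 ∂πm = OT cost bm ν :=
  h.symm.lintegral_eq_OT (by rwa [pairTotal, add_comm])

/-- The first plans of all optimal pairs lie on one graph. -/
theorem IsOptimalPair.exists_common_map [IsProbabilityMeasure bp]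
    (h : IsOptimalPair bp bm ν πp πm) (h' : IsOptimalPair bp bm ν' πp' πm')
    (hfin : pairTotal πp πm ≠ ∞) (hb : ∀ᵐ p ∂bp, p.2 ≠ 0) (hg : NullOnGraphs bp) :
    ∃ T : ℝ × ℝ → ℝ, Measurable T ∧ (∀ᵐ z ∂πp, z.2 = T z.1) ∧ ∀ᵐ z ∂πp', z.2 = T z.1 := by
  have ha := h.average h'
  have hfin' := ha.pairTotal_eq h ▸ hfin
  have hOT := ha.lintegral_eq_OT hfin'
  obtain ⟨T, hT, hTae⟩ := exists_map_of_optimal ha.plan_pos hOT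
    (hOT ▸ (ENNReal.add_ne_top.1 hfin').1) hb hg
  rw [Measure.ae_ennreal_smul_measure_iff (by simp), ae_add_measure_iff] at hTae
  exact ⟨T, hT, hTae⟩

/-- If a plan lies on the graph of `T`, then `T` transports the first marginal to the second. -/
theorem IsTransportPlan.map_eq {b : Measure (ℝ × ℝ)} {π : Measure ((ℝ × ℝ) × ℝ)}
    {T : ℝ × ℝ → ℝ} (h : IsTransportPlan b ν π) (hT : Measurable T)
    (hTae : ∀ᵐ z ∂π, z.2 = T z.1) : b.map T = ν := by
  rw [← h.1, ← h.2, Measure.map_map hT measurable_fst]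
  exact Measure.map_congr (hTae.mono fun z hz => hz.symm)

theorem IsTransportPlan.isOptimalTransportMap {b : Measure (ℝ × ℝ)} {π : Measure ((ℝ × ℝ) × ℝ)}
    {T : ℝ × ℝ → ℝ} (h : IsTransportPlan b ν π) (hT : Measurable T)
    (hTae : ∀ᵐ z ∂π, z.2 = T z.1) (hopt : ∫⁻ z, cost z.1 z.2 ∂π = OT cost b ν) :
    IsOptimalTransportMap cost b ν T := by
  refine ⟨hT, h.map_eq hT hTae, ?_⟩
  rw [← hopt, ← h.1, lintegral_map (f := fun x => cost x (T x)) (measurable_cost_comp measurable_id hT)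
    measurable_fst]
  exact lintegral_congr_ae (hTae.mono fun z hz => by simp only [hz])

theorem IsOptimalPair.marginal_unique [IsProbabilityMeasure bp]
    (h : IsOptimalPair bp bm ν πp πm) (h' : IsOptimalPair bp bm ν' πp' πm')
    (hfin : pairTotal πp πm ≠ ∞) (hb : ∀ᵐ p ∂bp, p.2 ≠ 0) (hg : NullOnGraphs bp) : ν = ν' := by
  obtain ⟨T, hT, h1, h2⟩ := h.exists_common_map h' hfin hb hg
  rw [← h.plan_pos.map_eq hT h1, h'.plan_pos.map_eq hT h2]

theorem isTransportPlan_of_map {α β δ : Type*} [MeasurableSpace α] [MeasurableSpace β]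
    [MeasurableSpace δ] (μ : Measure α) {u : α → β} {v : α → δ} (hu : Measurable u)
    (hv : Measurable v) : IsTransportPlan (μ.map u) (μ.map v) (μ.map fun x => (u x, v x)) := by
  constructor
  · rw [Measure.map_map measurable_fst (by fun_prop)]; rfl
  · rw [Measure.map_map measurable_snd (by fun_prop)]; rfl

/-- The optimal transport cost is attained. -/
theorem exists_plan_eq_OT {b : Measure (ℝ × ℝ)} [IsProbabilityMeasure b] [IsProbabilityMeasure ν]
    (hb : ∀ᵐ p ∂b, p.2 ≠ 0) :
    ∃ π, IsTransportPlan b ν π ∧ ∫⁻ z, cost z.1 z.2 ∂π = OT cost b ν := by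
  obtain ⟨π, hπ, hmin⟩ := exists_optimal_plan b ν (fun z => cost z.1 z.2)
    (fun n => (truncCost n).compContinuous ⟨fun z : (ℝ × ℝ) × ℝ => (z.1, (z.2, (0 : ℝ))),
      by fun_prop⟩) (fun z => monotone_truncCost (z.1, (z.2, 0))) (by
      intro π hπ
      have h1 : ∀ᵐ z ∂π, z.1.2 ≠ 0 := ae_of_ae_map measurable_fst.aemeasurable (hπ.1.symm ▸ hb)
      filter_upwards [h1] with z hz
      rw [cost_eq_ofReal hz]
      refine (iSup_truncCost (z := (z.1, (z.2, 0))) hz).trans ?_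
      simp [pairCost])
  exact ⟨π, hπ, le_antisymm (le_iInf₂ hmin) hπ.OT_le⟩

/-- With its converse below, this passes between minimizing over `ν` and minimizing over pairs of
plans, where averaging is available. -/
theorem IsBarycenter.isOptimalPair [IsProbabilityMeasure bp] (h : IsBarycenter bp bm ν)
    (hp : IsTransportPlan bp ν πp) (hm : IsTransportPlan bm ν πm)
    (hpe : ∫⁻ z, cost z.1 z.2 ∂πp = OT cost bp ν) (hme : ∫⁻ z, cost z.1 z.2 ∂πm = OT cost bm ν) :
    IsOptimalPair bp bm ν πp πm := by
  refine ⟨hp, hm, fun ν' πp' πm' hp' hm' => ?_⟩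
  rw [pairTotal, hpe, hme]
  exact (h.2 ν' hp'.isProbabilityMeasure_right).trans (add_le_add hp'.OT_le hm'.OT_le)

theorem IsOptimalPair.isBarycenter [IsProbabilityMeasure bp]
    (h : IsOptimalPair bp bm ν πp πm) (hfin : pairTotal πp πm ≠ ∞) : IsBarycenter bp bm ν := by
  refine ⟨h.plan_pos.isProbabilityMeasure_right, fun ν' _ => ?_⟩
  -- Truncated subtraction isolates each of the two infima in turn.
  rw [← h.lintegral_eq_OT hfin, ← h.lintegral_eq_OT' hfin, ← tsub_le_iff_right]
  refine le_iInf₂ fun π hπ => ?_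
  rw [tsub_le_iff_left, ← tsub_le_iff_right]
  refine le_iInf₂ fun π' hπ' => ?_
  rw [tsub_le_iff_left]
  exact h.le_pairTotal ν' π π' hπ hπ'

/-- An optimal transport map induces an optimal plan. -/
theorem IsOptimalTransportMap.plan {b : Measure (ℝ × ℝ)} {f : ℝ × ℝ → ℝ}
    (h : IsOptimalTransportMap cost b ν f) :
    IsTransportPlan b ν (b.map fun p => (p, f p)) ∧
      ∫⁻ z, cost z.1 z.2 ∂(b.map fun p => (p, f p)) = OT cost b ν := by
  obtain ⟨hf, hmap, hcost⟩ := h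
  refine ⟨?_, ?_⟩
  · have := isTransportPlan_of_map b measurable_id hf
    rwa [Measure.map_id, hmap] at this
  · rw [lintegral_map measurable_cost (by fun_prop)]
    exact hcost

end Barycenter

/-! ### Parity in terms of the Jordan decomposition -/

section JordanLemmas

variable {𝒳 : Type*} [MeasurableSpace 𝒳]

theorem add_jordan_negPart (μ₁ μ₂ : Measure 𝒳) [IsFiniteMeasure μ₁] [IsFiniteMeasure μ₂] :
    μ₁ + (jordan μ₁ μ₂).negPart = μ₂ + (jordan μ₁ μ₂).posPart := by
  have h := SignedMeasure.toSignedMeasure_toJordanDecomposition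
    (μ₁.toSignedMeasure - μ₂.toSignedMeasure)
  rw [JordanDecomposition.toSignedMeasure] at h
  change (jordan μ₁ μ₂).posPart.toSignedMeasure - (jordan μ₁ μ₂).negPart.toSignedMeasure = _ at h
  rw [← Measure.toSignedMeasure_eq_toSignedMeasure_iff, Measure.toSignedMeasure_add,
    Measure.toSignedMeasure_add, add_comm μ₂.toSignedMeasure]
  exact (sub_eq_sub_iff_add_eq_add.1 h).symm

variable {μ₁ μ₂ : Measure 𝒳} [IsProbabilityMeasure μ₁] [IsProbabilityMeasure μ₂]

theorem jordan_mass_eq :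
    (jordan μ₁ μ₂).negPart Set.univ = (jordan μ₁ μ₂).posPart Set.univ := by
  have h := congrArg (fun m : Measure 𝒳 => m Set.univ) (add_jordan_negPart μ₁ μ₂)
  simpa using h

theorem jordan_mass_ne_zero (hne : μ₁ ≠ μ₂) : (jordan μ₁ μ₂).posPart Set.univ ≠ 0 := by
  intro h
  have h' := jordan_mass_eq (μ₁ := μ₁) (μ₂ := μ₂)
  rw [h] at h'
  have := add_jordan_negPart μ₁ μ₂
  rw [Measure.measure_univ_eq_zero.1 h, Measure.measure_univ_eq_zero.1 h', add_zero,
    add_zero] at this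
  exact hne this

theorem isProbabilityMeasure_scaledPos (hne : μ₁ ≠ μ₂) :
    IsProbabilityMeasure (scaledPos μ₁ μ₂) := by
  constructor
  rw [scaledPos, Measure.smul_apply, smul_eq_mul,
    ENNReal.inv_mul_cancel (jordan_mass_ne_zero hne) (measure_ne_top _ _)]

theorem isProbabilityMeasure_scaledNeg (hne : μ₁ ≠ μ₂) :
    IsProbabilityMeasure (scaledNeg μ₁ μ₂) := by
  constructor
  rw [scaledNeg, Measure.smul_apply, smul_eq_mul,
    jordan_mass_eq,
    ENNReal.inv_mul_cancel (jordan_mass_ne_zero hne) (measure_ne_top _ _)]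

/-- A function has the same law under `μ₁` and `μ₂` if and only if it has the same law under the
scaled parts of the Jordan decomposition of `μ₁ - μ₂`. -/
theorem map_eq_map_iff_scaled (hne : μ₁ ≠ μ₂) {g : 𝒳 → ℝ} (hg : Measurable g) :
    μ₁.map g = μ₂.map g ↔ (scaledPos μ₁ μ₂).map g = (scaledNeg μ₁ μ₂).map g := by
  have h0 := jordan_mass_ne_zero hne
  have hadd : μ₁.map g + (jordan μ₁ μ₂).negPart.map g =
      μ₂.map g + (jordan μ₁ μ₂).posPart.map g := by
    rw [← Measure.map_add _ _ hg, ← Measure.map_add _ _ hg, add_jordan_negPart]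
  rw [scaledPos, scaledNeg, jordan_mass_eq, Measure.map_smul, Measure.map_smul]
  constructor
  · intro h
    ext A hA
    have e := congrArg (fun m : Measure ℝ => m A) hadd
    simp only [Measure.add_apply, h] at e
    simp only [Measure.smul_apply]
    rw [(ENNReal.add_right_inj (measure_ne_top _ _)).1 e]
  · intro h
    ext A hA
    have e := congrArg (fun m : Measure ℝ => m A) hadd
    have e' := congrArg (fun m : Measure ℝ => m A) h
    simp only [Measure.smul_apply, smul_eq_mul] at e'
    rw [ENNReal.mul_right_inj (ENNReal.inv_ne_zero.2 (measure_ne_top _ _))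
      (ENNReal.inv_ne_top.2 h0)] at e'
    simp only [Measure.add_apply, e'] at e
    exact (ENNReal.add_left_inj (measure_ne_top _ _)).1 e

end JordanLemmas

/-! ### Piecewise functions and the splitting of the squared distance -/

section Glue

variable {𝒳 : Type*} {ρp ρm : 𝒳 → ℝ≥0}

theorem glue_of_pos {fp fm fe : 𝒳 → ℝ} {x : 𝒳} (hx : ρp x ≠ 0) :
    glue ρp ρm fp fm fe x = fp x := if_pos (pos_iff_ne_zero.2 hx)

theorem glue_of_neg {fp fm fe : 𝒳 → ℝ} {x : 𝒳} (hx : ρp x = 0) (hx' : ρm x ≠ 0) :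
    glue ρp ρm fp fm fe x = fm x := by
  rw [glue, if_neg (by simp [hx]), if_pos (pos_iff_ne_zero.2 hx')]

theorem glue_of_zero {fp fm fe : 𝒳 → ℝ} {x : 𝒳} (hx : ρp x = 0) (hx' : ρm x = 0) :
    glue ρp ρm fp fm fe x = fe x := by
  rw [glue, if_neg (by simp [hx]), if_neg (by simp [hx'])]

end Glue

section Densities

variable {𝒳 : Type*} [MeasurableSpace 𝒳] {μ μp μm : Measure 𝒳} {ρp ρm : 𝒳 → ℝ≥0}

theorem AreDisjointDensities.eq_zero (h : AreDisjointDensities μ μp μm ρp ρm) {x : 𝒳}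
    (hx : ρp x ≠ 0) : ρm x = 0 := by
  by_contra hm
  exact Set.disjoint_left.1 h.disjoint (pos_iff_ne_zero.2 hx) (pos_iff_ne_zero.2 hm)

theorem measurable_glue (h : AreDisjointDensities μ μp μm ρp ρm) {fp fm fe : 𝒳 → ℝ}
    (hp : Measurable fp) (hm : Measurable fm) (he : Measurable fe) :
    Measurable (glue ρp ρm fp fm fe) := by
  classical
  have h1 : MeasurableSet {x | 0 < ρp x} := measurableSet_lt measurable_const h.measurable_pos
  have h2 : MeasurableSet {x | 0 < ρm x} := measurableSet_lt measurable_const h.measurable_neg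
  convert hp.ite h1 (hm.ite h2 he) using 2 with x
  unfold glue
  congr

theorem AreDisjointDensities.ae_pos_iff (h : AreDisjointDensities μ μp μm ρp ρm)
    {p : 𝒳 → Prop} : (∀ᵐ x ∂μp, p x) ↔ ∀ᵐ x ∂μ, ρp x ≠ 0 → p x := by
  rw [← h.density_pos, ae_withDensity_iff h.measurable_pos.coe_nnreal_ennreal]
  simp

theorem AreDisjointDensities.ae_neg_iff (h : AreDisjointDensities μ μp μm ρp ρm)
    {p : 𝒳 → Prop} : (∀ᵐ x ∂μm, p x) ↔ ∀ᵐ x ∂μ, ρm x ≠ 0 → p x := by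
  rw [← h.density_neg, ae_withDensity_iff h.measurable_neg.coe_nnreal_ennreal]
  simp

theorem AreDisjointDensities.glue_ae_pos (h : AreDisjointDensities μ μp μm ρp ρm)
    (fp fm fe : 𝒳 → ℝ) : glue ρp ρm fp fm fe =ᵐ[μp] fp :=
  h.ae_pos_iff.2 (ae_of_all _ fun _ hx => glue_of_pos hx)

theorem AreDisjointDensities.glue_ae_neg (h : AreDisjointDensities μ μp μm ρp ρm)
    (fp fm fe : 𝒳 → ℝ) : glue ρp ρm fp fm fe =ᵐ[μm] fm :=
  h.ae_neg_iff.2 (ae_of_all _ fun _ hx => glue_of_neg (by_contra fun h0 => hx (h.eq_zero h0)) hx)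

theorem AreDisjointDensities.Delta_ne_zero_pos (h : AreDisjointDensities μ μp μm ρp ρm) :
    ∀ᵐ x ∂μp, Delta ρp ρm x ≠ 0 :=
  h.ae_pos_iff.2 (ae_of_all _ fun x hx => by
    rw [Delta, glue_of_pos hx]; exact NNReal.coe_ne_zero.2 hx)

theorem AreDisjointDensities.Delta_ne_zero_neg (h : AreDisjointDensities μ μp μm ρp ρm) :
    ∀ᵐ x ∂μm, Delta ρp ρm x ≠ 0 :=
  h.ae_neg_iff.2 (ae_of_all _ fun x hx => by
    rw [Delta, glue_of_neg (by_contra fun h0 => hx (h.eq_zero h0)) hx]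
    exact neg_ne_zero.2 (NNReal.coe_ne_zero.2 hx))

theorem measurable_Delta (h : AreDisjointDensities μ μp μm ρp ρm) : Measurable (Delta ρp ρm) :=
  measurable_glue h h.measurable_pos.coe_nnreal_real h.measurable_neg.coe_nnreal_real.neg
    measurable_const

/-- The reason for dividing by `|d|` in the cost: the density of `μ±` cancels it and leaves the
squared error under `μ`. -/
theorem mul_cost {r : ℝ≥0} (hr : r ≠ 0) {p : ℝ × ℝ} (hp : |p.2| = r) (y : ℝ) :
    (r : ℝ≥0∞) * cost p y = ENNReal.ofReal ((p.1 - y) ^ 2) := by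
  rw [cost, hp, ENNReal.ofReal_coe_nnreal]
  exact ENNReal.mul_div_cancel (by simpa using hr) ENNReal.coe_ne_top

/-- The squared distance to `η` splits into transport costs and a part on `{Δ = 0}`. -/
theorem AreDisjointDensities.lintegral_sq_eq (h : AreDisjointDensities μ μp μm ρp ρm)
    {η f : 𝒳 → ℝ} (hη : Measurable η) (hf : Measurable f) :
    ∫⁻ x, ENNReal.ofReal ((η x - f x) ^ 2) ∂μ =
      (∫⁻ x, cost (η x, Delta ρp ρm x) (f x) ∂μp +
        ∫⁻ x, cost (η x, Delta ρp ρm x) (f x) ∂μm) +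
      ∫⁻ x in {x | ρp x = 0 ∧ ρm x = 0}, ENNReal.ofReal ((η x - f x) ^ 2) ∂μ := by
  have hc : Measurable fun x => cost (η x, Delta ρp ρm x) (f x) :=
    measurable_cost_comp (hη.prodMk (measurable_Delta h)) hf
  have hE : MeasurableSet {x | ρp x = 0 ∧ ρm x = 0} :=
    (h.measurable_pos (measurableSet_singleton 0)).inter
      (h.measurable_neg (measurableSet_singleton 0))
  rw [← h.density_pos, ← h.density_neg,
    lintegral_withDensity_eq_lintegral_mul _ h.measurable_pos.coe_nnreal_ennreal hc,
    lintegral_withDensity_eq_lintegral_mul _ h.measurable_neg.coe_nnreal_ennreal hc,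
    ← lintegral_indicator hE,
    ← lintegral_add_left (h.measurable_pos.coe_nnreal_ennreal.mul hc),
    ← lintegral_add_right _ ((by fun_prop : Measurable _).indicator hE)]
  refine lintegral_congr fun x => ?_
  simp only [Pi.mul_apply]
  by_cases hp : ρp x = 0
  · by_cases hm : ρm x = 0
    · simp [hp, hm]
    · have hx : x ∉ {x | ρp x = 0 ∧ ρm x = 0} := fun hx => hm hx.2
      rw [Set.indicator_of_notMem hx, hp, mul_cost hm]
      · simp
      · simp [Delta, glue_of_neg hp hm]
  · have hx : x ∉ {x | ρp x = 0 ∧ ρm x = 0} := fun hx => hp hx.1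
    rw [Set.indicator_of_notMem hx, h.eq_zero hp, mul_cost hp]
    · simp
    · simp [Delta, glue_of_pos hp]

end Densities

/-! ### The quadratic risk and demographic parity -/

section Risk

variable {Ω 𝒳 : Type*} [MeasurableSpace Ω] [MeasurableSpace 𝒳] {P : Measure Ω}
  {X : Ω → 𝒳} {S : Ω → ℕ} {Y : Ω → ℝ}

theorem memLp_two_iff_lintegral_sq {u : Ω → ℝ} (hu : AEStronglyMeasurable u P) :
    MemLp u 2 P ↔ ∫⁻ ω, ENNReal.ofReal (u ω ^ 2) ∂P ≠ ∞ := by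
  rw [memLp_two_iff_integrable_sq hu, Integrable,
    hasFiniteIntegral_iff_ofReal (ae_of_all _ fun ω => sq_nonneg (u ω)), lt_top_iff_ne_top]
  exact and_iff_right (hu.pow 2)

theorem ofReal_integral_sq {u : Ω → ℝ} (hu : MemLp u 2 P) :
    ENNReal.ofReal (∫ ω, u ω ^ 2 ∂P) = ∫⁻ ω, ENNReal.ofReal (u ω ^ 2) ∂P :=
  ofReal_integral_eq_lintegral_ofReal hu.integrable_sq (ae_of_all _ fun ω => sq_nonneg (u ω))

theorem IsBayesRegression.memLp {η : 𝒳 → ℝ} (hη : IsBayesRegression P X Y η)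
    (hY : MemLp Y 2 P) : MemLp (fun ω => η (X ω)) 2 P :=
  (memLp_congr_ae hη.2).2 (hY.condExp one_le_two)

variable [IsProbabilityMeasure P]

/-- `w(X)` is pulled out of the conditional expectation of `Y w(X)` given `X`; this removes the
cross term of the risk. -/
theorem IsBayesRegression.integral_mul_eq_zero {η : 𝒳 → ℝ} (hη : IsBayesRegression P X Y η)
    (hX : Measurable X) (hY : MemLp Y 2 P) {w : 𝒳 → ℝ} (hw : Measurable w)
    (hwL : MemLp (fun ω => w (X ω)) 2 P) : ∫ ω, (Y ω - η (X ω)) * w (X ω) ∂P = 0 := by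
  have hYw : Integrable (Y * fun ω => w (X ω)) P := hY.integrable_mul hwL
  have hηw : Integrable ((fun ω => η (X ω)) * fun ω => w (X ω)) P :=
    (hη.memLp hY).integrable_mul hwL
  have hm : StronglyMeasurable[MeasurableSpace.comap X inferInstance] fun ω => w (X ω) :=
    (hw.comp (comap_measurable X)).stronglyMeasurable
  have key : ∫ ω, (Y * fun ω => w (X ω)) ω ∂P =
      ∫ ω, ((fun ω => η (X ω)) * fun ω => w (X ω)) ω ∂P := by
    rw [← integral_condExp hX.comap_le]
    refine integral_congr_ae ?_
    filter_upwards [condExp_mul_of_stronglyMeasurable_right hm hYw (hY.integrable one_le_two),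
      hη.2] with ω h1 h2
    rw [h1, Pi.mul_apply, Pi.mul_apply, ← h2]
  have e : ∀ ω, (Y ω - η (X ω)) * w (X ω) =
      (Y * fun ω => w (X ω)) ω - ((fun ω => η (X ω)) * fun ω => w (X ω)) ω := fun ω => by
    simp only [Pi.mul_apply]; ring
  simp_rw [e]
  rw [integral_sub hYw hηw, key, sub_self]

/-- Bias-variance decomposition of the quadratic risk. -/
theorem IsBayesRegression.risk_eq {η : 𝒳 → ℝ} (hη : IsBayesRegression P X Y η)
    (hX : Measurable X) (hY : MemLp Y 2 P) {f : 𝒳 → ℝ} (hf : Measurable f) :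
    risk P X Y f = risk P X Y η + ∫⁻ x, ENNReal.ofReal ((η x - f x) ^ 2) ∂(P.map X) := by
  have hw : Measurable fun x => η x - f x := hη.1.sub hf
  rw [lintegral_map (by fun_prop) hX, risk, risk]
  have hZ : MemLp (fun ω => Y ω - η (X ω)) 2 P := hY.sub (hη.memLp hY)
  by_cases hW : MemLp (fun ω => η (X ω) - f (X ω)) 2 P
  · have hZW : MemLp (fun ω => Y ω - f (X ω)) 2 P := by
      convert hZ.add hW using 1
      ext ω
      simp
    rw [← ofReal_integral_sq hZ, ← ofReal_integral_sq hW, ← ofReal_integral_sq hZW,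
      ← ENNReal.ofReal_add (integral_nonneg fun ω => sq_nonneg _)
        (integral_nonneg fun ω => sq_nonneg _)]
    congr 1
    have hcross := hη.integral_mul_eq_zero hX hY hw hW
    have hint : Integrable (fun ω => (Y ω - η (X ω)) * (η (X ω) - f (X ω))) P :=
      hZ.integrable_mul hW
    calc ∫ ω, (Y ω - f (X ω)) ^ 2 ∂P
        = ∫ ω, ((Y ω - η (X ω)) ^ 2 + (η (X ω) - f (X ω)) ^ 2) +
            2 * ((Y ω - η (X ω)) * (η (X ω) - f (X ω))) ∂P :=
          integral_congr_ae (ae_of_all _ fun ω => by ring)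
      _ = _ := by
          have hsq : Integrable
              (fun ω => (Y ω - η (X ω)) ^ 2 + (η (X ω) - f (X ω)) ^ 2) P :=
            hZ.integrable_sq.add hW.integrable_sq
          rw [integral_add hsq (hint.const_mul 2),
            integral_add hZ.integrable_sq hW.integrable_sq, integral_const_mul, hcross]
          ring
  -- Here both sides are infinite, since `Y - η(X)` is square integrable.
  · have hfX : AEStronglyMeasurable (fun ω => f (X ω)) P :=
      (hf.comp hX).aestronglyMeasurable
    have hZW : ¬ MemLp (fun ω => Y ω - f (X ω)) 2 P := by
      intro hZW
      apply hW
      convert hZW.sub hZ using 1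
      ext ω
      simp
    have h1 := not_ne_iff.1 (hZW ∘ (memLp_two_iff_lintegral_sq (hY.1.sub hfX)).2)
    have h2 := not_ne_iff.1 (hW ∘ (memLp_two_iff_lintegral_sq ((hη.memLp hY).1.sub hfX)).2)
    exact h1.trans ((congrArg _ h2).trans (add_top _)).symm

theorem demographicParity_iff (hX : Measurable X) (hS : Measurable S)
    (hS12 : ∀ ω, S ω = 1 ∨ S ω = 2) (hp₁ : 0 < P (S ⁻¹' {1})) (hp₂ : 0 < P (S ⁻¹' {2}))
    {g : 𝒳 → ℝ} (hg : Measurable g) :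
    DemographicParity P X S g ↔ (condLaw P X S 1).map g = (condLaw P X S 2).map g := by
  have hm : ∀ s : ℕ, MeasurableSet (S ⁻¹' {s}) := fun s => hS (measurableSet_singleton s)
  have hlaw : ∀ (s : ℕ) (A : Set ℝ), MeasurableSet A →
      (condLaw P X S s).map g A = (P (S ⁻¹' {s}))⁻¹ * P ((fun ω => g (X ω)) ⁻¹' A ∩ S ⁻¹' {s}) := by
    intro s A hA
    rw [condLaw, Measure.map_map hg hX, Measure.map_apply (hg.comp hX) hA, cond_apply (hm s),
      Set.inter_comm]
    rfl
  have hsplit : ∀ E : Set Ω, P E = P (E ∩ S ⁻¹' {1}) + P (E ∩ S ⁻¹' {2}) := by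
    intro E
    rw [← measure_inter_add_sdiff E (hm 1)]
    congr 2
    ext ω
    have := hS12 ω
    simp only [Set.mem_sdiff, Set.mem_inter_iff, Set.mem_preimage, Set.mem_singleton_iff]
    grind
  rw [DemographicParity, indepFun_iff_measure_inter_preimage_eq_mul]
  constructor
  · intro h
    ext A hA
    rw [hlaw 1 A hA, hlaw 2 A hA, h A {1} hA (measurableSet_singleton _),
      h A {2} hA (measurableSet_singleton _), mul_left_comm, mul_left_comm (P (S ⁻¹' {2}))⁻¹,
      ENNReal.inv_mul_cancel hp₁.ne' (measure_ne_top _ _),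
      ENNReal.inv_mul_cancel hp₂.ne' (measure_ne_top _ _)]
  · intro h A T hA _
    set E := (fun ω => g (X ω)) ⁻¹' A
    set q := (condLaw P X S 1).map g A
    have e1 : P (E ∩ S ⁻¹' {1}) = P (S ⁻¹' {1}) * q := by
      rw [show q = _ from hlaw 1 A hA, ← mul_assoc,
        ENNReal.mul_inv_cancel hp₁.ne' (measure_ne_top _ _), one_mul]
    have e2 : P (E ∩ S ⁻¹' {2}) = P (S ⁻¹' {2}) * q := by
      rw [show q = _ from (congrArg (fun m : Measure ℝ => m A) h).trans (hlaw 2 A hA), ← mul_assoc,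
        ENNReal.mul_inv_cancel hp₂.ne' (measure_ne_top _ _), one_mul]
    have hsum : P (S ⁻¹' {1}) + P (S ⁻¹' {2}) = 1 := by
      have := hsplit Set.univ
      rw [measure_univ, Set.univ_inter, Set.univ_inter] at this
      exact this.symm
    have hE : P E = q := by rw [hsplit E, e1, e2, ← add_mul, hsum, one_mul]
    -- On `{S = s}` the event `{S ∈ T}` is everything or empty.
    have hpart : ∀ s : ℕ, P (E ∩ S ⁻¹' {s}) = P (S ⁻¹' {s}) * q →
        P (E ∩ S ⁻¹' T ∩ S ⁻¹' {s}) = q * P (S ⁻¹' T ∩ S ⁻¹' {s}) := by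
      intro s hs
      by_cases hsT : s ∈ T
      · have hsub : S ⁻¹' {s} ⊆ S ⁻¹' T := Set.preimage_mono (Set.singleton_subset_iff.2 hsT)
        rw [Set.inter_assoc, Set.inter_eq_right.2 hsub, hs, mul_comm]
      · have : S ⁻¹' T ∩ S ⁻¹' {s} = ∅ := by
          rw [← Set.preimage_inter, Set.inter_singleton_eq_empty.2 hsT, Set.preimage_empty]
        rw [Set.inter_assoc, this]
        simp
    rw [hE, hsplit (E ∩ S ⁻¹' T), hsplit (S ⁻¹' T), hpart 1 e1, hpart 2 e2, mul_add]

end Risk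

/-! ### Regression functions as pairs of plans -/

section Main

variable {𝒳 : Type*} [MeasurableSpace 𝒳] {μ μp μm : Measure 𝒳} {ρp ρm : 𝒳 → ℝ≥0} {η : 𝒳 → ℝ}

/-- The transport plan induced by a function on the feature space. -/
def inducedPlan (μ : Measure 𝒳) (η Δ f : 𝒳 → ℝ) : Measure ((ℝ × ℝ) × ℝ) :=
  μ.map fun x => ((η x, Δ x), f x)

theorem inducedPlan_congr {Δ f g : 𝒳 → ℝ} (h : f =ᵐ[μ] g) :
    inducedPlan μ η Δ f = inducedPlan μ η Δ g :=
  Measure.map_congr (h.mono fun x hx => by simp only [hx])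

theorem isTransportPlan_inducedPlan {Δ f : 𝒳 → ℝ} (hη : Measurable η) (hΔ : Measurable Δ)
    (hf : Measurable f) :
    IsTransportPlan (featureLaw μ η Δ) (μ.map f) (inducedPlan μ η Δ f) :=
  isTransportPlan_of_map μ (hη.prodMk hΔ) hf

theorem inducedPlan_comp {Δ : 𝒳 → ℝ} {f : ℝ × ℝ → ℝ} (hη : Measurable η) (hΔ : Measurable Δ)
    (hf : Measurable f) :
    inducedPlan μ η Δ (fun x => f (η x, Δ x)) = (featureLaw μ η Δ).map fun p => (p, f p) := by
  rw [featureLaw, Measure.map_map (by fun_prop) (hη.prodMk hΔ)]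
  rfl

theorem lintegral_inducedPlan {Δ f : 𝒳 → ℝ} (hη : Measurable η) (hΔ : Measurable Δ)
    (hf : Measurable f) :
    ∫⁻ z, cost z.1 z.2 ∂(inducedPlan μ η Δ f) = ∫⁻ x, cost (η x, Δ x) (f x) ∂μ :=
  lintegral_map measurable_cost ((hη.prodMk hΔ).prodMk hf)

theorem ae_inducedPlan_iff {Δ f : 𝒳 → ℝ} (hη : Measurable η) (hΔ : Measurable Δ)
    (hf : Measurable f) {T : ℝ × ℝ → ℝ} (hT : Measurable T) :
    (∀ᵐ z ∂(inducedPlan μ η Δ f), z.2 = T z.1) ↔ ∀ᵐ x ∂μ, f x = T (η x, Δ x) :=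
  ae_map_iff ((hη.prodMk hΔ).prodMk hf).aemeasurable
    (measurableSet_eq_fun measurable_snd (hT.comp measurable_fst))

theorem featureLaw_ae_ne_zero {Δ : 𝒳 → ℝ} (hη : Measurable η) (hΔ : Measurable Δ)
    (h : ∀ᵐ x ∂μ, Δ x ≠ 0) : ∀ᵐ p ∂(featureLaw μ η Δ), p.2 ≠ 0 :=
  (ae_map_iff (hη.prodMk hΔ).aemeasurable
    (measurable_snd (measurableSet_singleton (0 : ℝ)).compl)).2 h

theorem isOptimalPair_fst_unique {bp bm : Measure (ℝ × ℝ)} {ν ν' : Measure ℝ}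
    {πm πm' : Measure ((ℝ × ℝ) × ℝ)} [IsProbabilityMeasure μp]
    {Δ f g : 𝒳 → ℝ} (hη : Measurable η) (hΔ : Measurable Δ) (hf : Measurable f)
    (hg : Measurable g) (hbp : bp = featureLaw μp η Δ) (hb : ∀ᵐ p ∂bp, p.2 ≠ 0)
    (hnull : NullOnGraphs bp)
    (h : IsOptimalPair bp bm ν (inducedPlan μp η Δ f) πm)
    (h' : IsOptimalPair bp bm ν' (inducedPlan μp η Δ g) πm')
    (hfin : pairTotal (inducedPlan μp η Δ f) πm ≠ ∞) : f =ᵐ[μp] g := by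
  have : IsProbabilityMeasure bp := by
    rw [hbp]
    exact Measure.isProbabilityMeasure_map (hη.prodMk hΔ).aemeasurable
  obtain ⟨T, hT, h1, h2⟩ := h.exists_common_map h' hfin hb hnull
  rw [ae_inducedPlan_iff hη hΔ hf hT] at h1
  rw [ae_inducedPlan_iff hη hΔ hg hT] at h2
  filter_upwards [h1, h2] with x h1 h2
  rw [h1, h2]

/-- The best `L²(μ)`-approximation of `η` by functions with the same law under `μp` and `μm` is
obtained from the optimal transport maps to the barycenter. -/
theorem barycenter_solution [IsProbabilityMeasure μp] [IsProbabilityMeasure μm]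
    (hρ : AreDisjointDensities μ μp μm ρp ρm) (hη : Measurable η)
    (hη2 : ∫⁻ x, ENNReal.ofReal (η x ^ 2) ∂μ ≠ ∞) {bp bm : Measure (ℝ × ℝ)} {Δ : 𝒳 → ℝ}
    (hΔ : Δ = Delta ρp ρm)
    (hbp : bp = featureLaw μp η Δ) (hbm : bm = featureLaw μm η Δ)
    (hgp : NullOnGraphs bp) (hgm : NullOnGraphs bm) :
    ∃ ν : Measure ℝ, IsBarycenter bp bm ν ∧ (∀ ν', IsBarycenter bp bm ν' → ν' = ν) ∧
      (∃ fp fm, IsOptimalTransportMap cost bp ν fp ∧ IsOptimalTransportMap cost bm ν fm) ∧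
      ∀ fp fm, IsOptimalTransportMap cost bp ν fp → IsOptimalTransportMap cost bm ν fm →
        ∀ F, F = glue ρp ρm (fun x => fp (η x, Δ x)) (fun x => fm (η x, Δ x)) η →
          Measurable F ∧ μp.map F = μm.map F ∧
          ∀ g, Measurable g → μp.map g = μm.map g →
            ∫⁻ x, ENNReal.ofReal ((η x - F x) ^ 2) ∂μ ≤
              ∫⁻ x, ENNReal.ofReal ((η x - g x) ^ 2) ∂μ ∧
            (∫⁻ x, ENNReal.ofReal ((η x - g x) ^ 2) ∂μ ≤
              ∫⁻ x, ENNReal.ofReal ((η x - F x) ^ 2) ∂μ → g =ᵐ[μ] F) := by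
  have hΔm : Measurable Δ := hΔ ▸ measurable_Delta hρ
  have : IsProbabilityMeasure bp :=
    hbp ▸ Measure.isProbabilityMeasure_map (hη.prodMk hΔm).aemeasurable
  have : IsProbabilityMeasure bm :=
    hbm ▸ Measure.isProbabilityMeasure_map (hη.prodMk hΔm).aemeasurable
  have hp : ∀ᵐ p ∂bp, p.2 ≠ 0 :=
    hbp ▸ featureLaw_ae_ne_zero hη hΔm (hΔ ▸ hρ.Delta_ne_zero_pos)
  have hm : ∀ᵐ p ∂bm, p.2 ≠ 0 :=
    hbm ▸ featureLaw_ae_ne_zero hη hΔm (hΔ ▸ hρ.Delta_ne_zero_neg)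
  have hplan_p : ∀ {g : 𝒳 → ℝ}, Measurable g →
      IsTransportPlan bp (μp.map g) (inducedPlan μp η Δ g) := fun hg =>
    hbp ▸ isTransportPlan_inducedPlan hη hΔm hg
  have hplan_m : ∀ {g : 𝒳 → ℝ}, Measurable g →
      IsTransportPlan bm (μm.map g) (inducedPlan μm η Δ g) := fun hg =>
    hbm ▸ isTransportPlan_inducedPlan hη hΔm hg
  have hsplit : ∀ {g : 𝒳 → ℝ}, Measurable g → ∫⁻ x, ENNReal.ofReal ((η x - g x) ^ 2) ∂μ =
      pairTotal (inducedPlan μp η Δ g) (inducedPlan μm η Δ g) +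
        ∫⁻ x in {x | ρp x = 0 ∧ ρm x = 0}, ENNReal.ofReal ((η x - g x) ^ 2) ∂μ := fun hg => by
    rw [pairTotal, lintegral_inducedPlan hη hΔm hg, lintegral_inducedPlan hη hΔm hg, hΔ,
      hρ.lintegral_sq_eq hη hg]
  obtain ⟨ν, πp, πm, -, hπp, hπm, hle⟩ := exists_optimal_pair hp hm
  have hopt : IsOptimalPair bp bm ν πp πm := ⟨hπp, hπm, hle⟩
  have hfin : pairTotal πp πm ≠ ∞ := by
    -- The zero function has law `δ₀` under both measures, and its total cost is at most `∫ η² dμ`.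
    have hz := hsplit (g := fun _ => 0) measurable_const
    simp only [sub_zero] at hz
    rw [hz] at hη2
    have hsame : μm.map (fun _ => (0 : ℝ)) = μp.map (fun _ => (0 : ℝ)) := by
      simp [Measure.map_const]
    exact ne_top_of_le_ne_top (ENNReal.add_ne_top.1 hη2).1
      (hle _ _ _ (hplan_p measurable_const) (hsame ▸ hplan_m measurable_const))
  have hπpe := hopt.lintegral_eq_OT hfin
  have hπme := hopt.lintegral_eq_OT' hfin
  have hfin' := ENNReal.add_ne_top.1 hfin
  refine ⟨ν, hopt.isBarycenter hfin, fun ν' hν' => ?_, ?_, ?_⟩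
  · have := hν'.1
    obtain ⟨πp', hp1, hp2⟩ := exists_plan_eq_OT (ν := ν') hp
    obtain ⟨πm', hm1, hm2⟩ := exists_plan_eq_OT (ν := ν') hm
    exact (hopt.marginal_unique (hν'.isOptimalPair hp1 hm1 hp2 hm2) hfin hp hgp).symm
  · obtain ⟨fp, hfp, hfpe⟩ := exists_map_of_optimal hπp hπpe (hπpe ▸ hfin'.1) hp hgp
    obtain ⟨fm, hfm, hfme⟩ := exists_map_of_optimal hπm hπme (hπme ▸ hfin'.2) hm hgm
    exact ⟨fp, fm, hπp.isOptimalTransportMap hfp hfpe hπpe,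
      hπm.isOptimalTransportMap hfm hfme hπme⟩
  intro fp fm hfp hfm F hF
  have hFm : Measurable F := hF ▸ measurable_glue hρ (hfp.1.comp (hη.prodMk hΔm))
    (hfm.1.comp (hη.prodMk hΔm)) hη
  have hFp : F =ᵐ[μp] fun x => fp (η x, Δ x) := hF ▸ hρ.glue_ae_pos _ _ _
  have hFn : F =ᵐ[μm] fun x => fm (η x, Δ x) := hF ▸ hρ.glue_ae_neg _ _ _
  have hlawp : μp.map F = ν := by
    rw [Measure.map_congr hFp, ← hfp.2.1, hbp, featureLaw,
      Measure.map_map hfp.1 (hη.prodMk hΔm)]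
    rfl
  have hlawm : μm.map F = ν := by
    rw [Measure.map_congr hFn, ← hfm.2.1, hbm, featureLaw,
      Measure.map_map hfm.1 (hη.prodMk hΔm)]
    rfl
  have hcp : ∫⁻ z, cost z.1 z.2 ∂(inducedPlan μp η Δ F) = OT cost bp ν := by
    rw [inducedPlan_congr hFp, inducedPlan_comp hη hΔm hfp.1, ← hbp]
    exact hfp.plan.2
  have hcm : ∫⁻ z, cost z.1 z.2 ∂(inducedPlan μm η Δ F) = OT cost bm ν := by
    rw [inducedPlan_congr hFn, inducedPlan_comp hη hΔm hfm.1, ← hbm]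
    exact hfm.plan.2
  have hFtot : pairTotal (inducedPlan μp η Δ F) (inducedPlan μm η Δ F) = pairTotal πp πm := by
    rw [pairTotal, pairTotal, hcp, hcm, hπpe, hπme]
  have hFopt : IsOptimalPair bp bm ν (inducedPlan μp η Δ F) (inducedPlan μm η Δ F) :=
    hopt.of_pairTotal_le (hlawp ▸ hplan_p hFm) (hlawm ▸ hplan_m hFm) hFtot.le
  have hE : MeasurableSet {x | ρp x = 0 ∧ ρm x = 0} :=
    (hρ.measurable_pos (measurableSet_singleton 0)).inter
      (hρ.measurable_neg (measurableSet_singleton 0))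
  -- `F = η` where both densities vanish, so the remainder is zero.
  have hFe : ∫⁻ x, ENNReal.ofReal ((η x - F x) ^ 2) ∂μ =
      pairTotal (inducedPlan μp η Δ F) (inducedPlan μm η Δ F) := by
    rw [hsplit hFm, setLIntegral_congr_fun (g := fun _ => 0) hE fun x hx => ?_]
    · simp
    · simp [hF, glue_of_zero hx.1 hx.2]
  refine ⟨hFm, hlawp.trans hlawm.symm, fun g hg hlaw => ?_⟩
  have hgle := hFopt.le_pairTotal _ _ _ (hplan_p hg) (hlaw ▸ hplan_m hg)
  rw [hFe, hsplit hg]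
  refine ⟨hgle.trans le_self_add, fun hle' => ?_⟩
  -- A competitor as good as `F` must induce an optimal pair and have zero remainder. The first fact
  -- gives `g = F` a.e. where a density is positive, the second `g = η` a.e. elsewhere.
  have hgopt : IsOptimalPair bp bm (μp.map g) (inducedPlan μp η Δ g) (inducedPlan μm η Δ g) :=
    hFopt.of_pairTotal_le (hplan_p hg) (hlaw ▸ hplan_m hg) (le_self_add.trans hle')
  have hgfin : pairTotal (inducedPlan μp η Δ g) (inducedPlan μm η Δ g) ≠ ∞ :=
    hgopt.pairTotal_eq hopt ▸ hfin
  have hp' := hρ.ae_pos_iff.1 (isOptimalPair_fst_unique hη hΔm hg hFm hbp hp hgp hgopt hFopt hgfin)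
  have hm' := hρ.ae_neg_iff.1 (isOptimalPair_fst_unique hη hΔm hg hFm hbm hm hgm hgopt.symm
    hFopt.symm (by rwa [pairTotal, add_comm]))
  have hrest : ∫⁻ x in {x | ρp x = 0 ∧ ρm x = 0}, ENNReal.ofReal ((η x - g x) ^ 2) ∂μ = 0 := by
    rw [hFopt.pairTotal_eq hgopt] at hle'
    refine le_antisymm ((ENNReal.add_le_add_iff_left hgfin).1 ?_) zero_le
    rwa [add_zero]
  rw [lintegral_eq_zero_iff (by fun_prop)] at hrest
  have hz := (ae_restrict_iff' hE).1 hrest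
  filter_upwards [hp', hm', hz] with x h1 h2 h3
  by_cases hxp : ρp x = 0
  · by_cases hxm : ρm x = 0
    · have h4 := h3 ⟨hxp, hxm⟩
      have h5 : (η x - g x) ^ 2 ≤ 0 := ENNReal.ofReal_eq_zero.1 h4
      have h6 : η x - g x = 0 := pow_eq_zero_iff two_ne_zero |>.1 (le_antisymm h5 (sq_nonneg _))
      rw [hF, glue_of_zero hxp hxm]
      linarith
    · exact h2 hxm
  · exact h1 hxp

end Main

end FairRegression

end

theorem mainTheorem1 {Ω 𝒳 : Type*} [MeasurableSpace Ω] [MeasurableSpace 𝒳]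
    (P : Measure Ω) [IsProbabilityMeasure P]
    (X : Ω → 𝒳) (S : Ω → ℕ) (Y : Ω → ℝ)
    (hX : Measurable X) (hS : Measurable S) (hY : Measurable Y)
    (hS12 : ∀ ω, S ω = 1 ∨ S ω = 2)
    (hp₁ : 0 < P (S ⁻¹' {1})) (hp₂ : 0 < P (S ⁻¹' {2}))
    (hY2 : MemLp Y 2 P)
    (hne : FairRegression.condLaw P X S 1 ≠ FairRegression.condLaw P X S 2)
    (η : 𝒳 → ℝ) (hη : FairRegression.IsBayesRegression P X Y η)
    (ρp ρm : 𝒳 → ℝ≥0)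
    (hρ : FairRegression.AreDisjointDensities (P.map X)
      (FairRegression.muPos P X S) (FairRegression.muNeg P X S) ρp ρm)
    (Δ : 𝒳 → ℝ) (hΔ : Δ = FairRegression.Delta ρp ρm)
    (bp bm : Measure (ℝ × ℝ))
    (hbp : bp = FairRegression.featureLaw (FairRegression.muPos P X S) η Δ)
    (hbm : bm = FairRegression.featureLaw (FairRegression.muNeg P X S) η Δ)
    (hgp : FairRegression.NullOnGraphs bp) (hgm : FairRegression.NullOnGraphs bm) :
    ∃ ν : Measure ℝ,
      FairRegression.IsBarycenter bp bm ν ∧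
      (∀ ν' : Measure ℝ, FairRegression.IsBarycenter bp bm ν' → ν' = ν) ∧
      (∃ fp fm : ℝ × ℝ → ℝ,
        FairRegression.IsOptimalTransportMap FairRegression.cost bp ν fp ∧
        FairRegression.IsOptimalTransportMap FairRegression.cost bm ν fm) ∧
      (∀ fp fm : ℝ × ℝ → ℝ,
        FairRegression.IsOptimalTransportMap FairRegression.cost bp ν fp →
        FairRegression.IsOptimalTransportMap FairRegression.cost bm ν fm →
        FairRegression.IsOptimalFair P X S Y
          (FairRegression.glue ρp ρm (fun x => fp (η x, Δ x)) (fun x => fm (η x, Δ x)) η) ∧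
        ∀ g : 𝒳 → ℝ, FairRegression.IsOptimalFair P X S Y g →
          g =ᵐ[P.map X]
            FairRegression.glue ρp ρm (fun x => fp (η x, Δ x)) (fun x => fm (η x, Δ x)) η) := by
  have hμ₁ : IsProbabilityMeasure (FairRegression.condLaw P X S 1) :=
    have := cond_isProbabilityMeasure hp₁.ne'
    Measure.isProbabilityMeasure_map hX.aemeasurable
  have hμ₂ : IsProbabilityMeasure (FairRegression.condLaw P X S 2) :=
    have := cond_isProbabilityMeasure hp₂.ne'
    Measure.isProbabilityMeasure_map hX.aemeasurable
  have hμp : IsProbabilityMeasure (FairRegression.muPos P X S) :=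
    FairRegression.isProbabilityMeasure_scaledPos hne
  have hμm : IsProbabilityMeasure (FairRegression.muNeg P X S) :=
    FairRegression.isProbabilityMeasure_scaledNeg hne
  have hparity : ∀ {g : 𝒳 → ℝ}, Measurable g → (FairRegression.DemographicParity P X S g ↔
      (FairRegression.muPos P X S).map g = (FairRegression.muNeg P X S).map g) := fun hg =>
    (FairRegression.demographicParity_iff hX hS hS12 hp₁ hp₂ hg).trans
      (FairRegression.map_eq_map_iff_scaled hne hg)
  have hη2 : ∫⁻ x, ENNReal.ofReal (η x ^ 2) ∂(P.map X) ≠ ∞ := by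
    rw [lintegral_map (hη.1.pow_const 2).ennreal_ofReal hX]
    exact (FairRegression.memLp_two_iff_lintegral_sq
      (hη.1.comp hX).aestronglyMeasurable).1 (hη.memLp hY2)
  -- Finiteness is what allows the Bayes risk to be cancelled when two minimizers are compared.
  have hrisk : FairRegression.risk P X Y η ≠ ∞ :=
    (FairRegression.memLp_two_iff_lintegral_sq
      (hY.sub (hη.1.comp hX)).aestronglyMeasurable).1 (hY2.sub (hη.memLp hY2))
  obtain ⟨ν, hν, huniq, hmaps, hsol⟩ :=
    FairRegression.barycenter_solution hρ hη.1 hη2 hΔ hbp hbm hgp hgm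
  refine ⟨ν, hν, huniq, hmaps, fun fp fm hfp hfm => ?_⟩
  obtain ⟨hFm, hFlaw, hF⟩ := hsol fp fm hfp hfm _ rfl
  refine ⟨⟨hFm, (hparity hFm).2 hFlaw, fun g hg hgp => ?_⟩, fun g hg => ?_⟩
  · rw [hη.risk_eq hX hY2 hFm, hη.risk_eq hX hY2 hg]
    exact add_le_add le_rfl (hF g hg ((hparity hg).1 hgp)).1
  · have h := hg.2.2 _ hFm ((hparity hFm).2 hFlaw)
    rw [hη.risk_eq hX hY2 hFm, hη.risk_eq hX hY2 hg.1, ENNReal.add_le_add_iff_left hrisk] at h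
    exact (hF g hg.1 ((hparity hg.1).1 hg.2.1)).2 h
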